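/- **Theorem 3.20.** Let $\mathbf k$ be a field of characteristic $0$. A $\lambda$-product on a $\mathbf k[\partial]$-module $P$ is a $\mathbf k$-bilinear map $P\times P\to P[\lambda]$, $(a,b)\mapsto a\ast_\lambda b$, with $(\partial a)\ast_\lambda b=-\lambda\, a\ast_\lambda b$ and $a\ast_\lambda(\partial b)=(\partial+\lambda)(a\ast_\lambda b)$. A *pre-Poisson conformal algebra* $(P,\circ_\lambda,\succ_\lambda)$ is a $\mathbf k[\partial]$-module $P$ with two $\lambda$-products such that, for all $a,b,c\in P$, $$a\circ_\lambda(b\circ_\mu c)-(a\circ_\lambda b)\circ_{\lambda+\mu}c=b\circ_\mu(a\circ_\lambda c)-(b\circ_\mu a)\circ_{\lambda+\mu}c,$$ $$a\succ_\lambda(b\succ_\mu c)=(a\succ_\lambda b+b\succ_{-\lambda-\partial}a)\succ_{\lambda+\mu}c,$$ $$(a\circ_\lambda b-b\circ_{-\lambda-\partial}a)\succ_{\lambda+\mu}c=a\circ_\lambda(b\succ_\mu c)-b\succ_\mu(a\circ_\lambda c),$$ $$(a\succ_\lambda b+b\succ_{-\lambda-\partial}a)\circ_{\lambda+\mu}c=a\succ_\lambda(b\circ_\mu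 c)+b\succ_\mu(a\circ_\lambda c).$$ A *Poisson conformal algebra* $(A,[\cdot_\lambda\cdot],\cdot_\lambda\cdot)$ is a $\mathbf k[\partial]$-module $A$ with two $\lambda$-products such that $[a_\lambda b]=-[b_{-\lambda-\partial}a]$, $[a_\lambda[b_\mu c]]=[[a_\lambda b]_{\lambda+\mu}c]+[b_\mu[a_\lambda c]]$, $a_\lambda b=b_{-\lambda-\partial}a$, $(a_\lambda b)_{\lambda+\mu}c=a_\lambda(b_\mu c)$ and $[a_\lambda(b_\mu c)]=[a_\lambda b]_{\lambda+\mu}c+b_\mu[a_\lambda c]$ for all $a,b,c\in A$. An element $r=\sum_i r_i\otimes l_i\in A\otimes_{\mathbf k}A$ is a *solution of the Poisson conformal Yang–Baxter equation (PCYBE) in $A$* if, with $I$ the identity map, $\partial^{\otimes^2}=\partial\otimes I+I\otimes\partial$ and $\partial^{\otimes^3}=\partial\otimes I\otimes I+I\otimes\partial\otimes I+I\otimes I\otimes\partial$, the two elements $$[[r,r]]=\sum_{i,j}\Big([{r_i}_\mu r_j]\otimes l_i\otimes l_j\big|_{\mu=I\otimes\partial\otimes I}-r_i\otimes[{r_j}_\mu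 l_i]\otimes l_j\big|_{\mu=I\otimes I\otimes\partial}-r_i\otimes r_j\otimes[{l_j}_\mu l_i]\big|_{\mu=I\otimes\partial\otimes I}\Big),$$ $$r\bullet r=\sum_{i,j}\Big(r_i\otimes r_j\otimes {l_i}_\mu l_j\big|_{\mu=\partial\otimes I\otimes I}-r_i\otimes{r_j}_\mu l_i\otimes l_j\big|_{\mu=-\partial^{\otimes^2}\otimes I}+{r_i}_\mu r_j\otimes l_i\otimes l_j\big|_{\mu=I\otimes\partial\otimes I}\Big)$$ both lie in $\partial^{\otimes^3}(A\otimes A\otimes A)$. Let $(P,\circ_\lambda,\succ_\lambda)$ be a pre-Poisson conformal algebra in which $P$ is a free $\mathbf k[\partial]$-module with finite basis $e_1,\dots,e_n$. Let $P^{*c}=\{f:P\to\mathbf k[\lambda]\ \mathbf k\text{-linear}: f_\lambda(\partial b)=\lambda f_\lambda(b)\}$ be the conformal dual, a $\mathbf k[\partial]$-module by $(\partial f)_\lambda=-\lambda f_\lambda$, and let $e_1^*,\dots,e_n^*$ be the dual basis, $(e_i^*)_\lambda(e_j)=\delta_{ij}$. For $a\in P$ and $f\in P^{*c}$ define $\mathfrak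 L_\circ^*(a)_\lambda f,\ \mathfrak L_\succ^*(a)_\lambda f\in P^{*c}[\lambda]$ by $$(\mathfrak L_\circ^*(a)_\lambda f)_\mu u=-f_{\mu-\lambda}(a\circ_\lambda u),\qquad(\mathfrak L_\succ^*(a)_\lambda f)_\mu u=-f_{\mu-\lambda}(a\succ_\lambda u)\qquad(u\in P).$$ Then $P$ with $$[a_\lambda b]=a\circ_\lambda b-b\circ_{-\lambda-\partial}a,\qquad a_\lambda b=a\succ_\lambda b+b\succ_{-\lambda-\partial}a$$ is a Poisson conformal algebra (the associated one); the semi-direct product $P\ltimes_{\mathfrak L_\circ^*,-\mathfrak L_\succ^*}P^{*c}$, that is, the $\mathbf k[\partial]$-module $P\oplus P^{*c}$ with $$[(a+f)_\lambda(b+g)]=[a_\lambda b]+\mathfrak L_\circ^*(a)_\lambda g-\mathfrak L_\circ^*(b)_{-\lambda-\partial}f,\qquad (a+f)_\lambda(b+g)=a_\lambda b-\mathfrak L_\succ^*(a)_\lambda g-\mathfrak L_\succ^*(b)_{-\lambda-\partial}f$$ for $a,b\in P$ and $f,g\in P^{*c}$, is a Poisson conformal algebra; and $$r=\sum_{i=1}^n(e_i\otimes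 e_i^*-e_i^*\otimes e_i)$$ is a solution of the PCYBE in $P\ltimes_{\mathfrak L_\circ^*,-\mathfrak L_\succ^*}P^{*c}$. -/

import Mathlib

open scoped Polynomial TensorProduct

noncomputable section

namespace PoissonConformal

/-! ### Polynomials with coefficients in a module

`V[λ]` is `ℕ →₀ V` (the coefficient of `λ ^ n` is the value at `n`), and `V[λ, μ]` is `V[μ][λ]`, that
is `ℕ →₀ ℕ →₀ V`, the outer variable being `λ`.  A `k[∂]`-module is a `k[X]`-module, `∂` acting as
`X`; its underlying vector space structure is the compatible `k`-module structure. -/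

section Poly

variable (k : Type*) [Field k]

/-- The action of `∂` on a `k[∂]`-module, as a `k`-linear map. -/
def del (V : Type*) [AddCommGroup V] [Module k V] [Module k[X] V] [IsScalarTower k k[X] V] :
    Module.End k V :=
  Algebra.lsmul k k V (Polynomial.X : k[X])

variable (V : Type*) [AddCommGroup V] [Module k V]

/-- Multiplication by the variable `λ` on `V[λ]`. -/
def var : Module.End k (ℕ →₀ V) := Finsupp.lmapDomain V k (fun n => n + 1)

/-- The inclusion of `V` into `V[λ]` as constant polynomials. -/
def const : V →ₗ[k] (ℕ →₀ V) := Finsupp.lsingle 0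

/-- Multiplication by `λ` on `V[λ, μ]`. -/
def varL : Module.End k (ℕ →₀ ℕ →₀ V) := var k (ℕ →₀ V)

/-- Multiplication by `μ` on `V[λ, μ]`. -/
def varM : Module.End k (ℕ →₀ ℕ →₀ V) := Finsupp.mapRange.linearMap (var k V)

/-- The inclusion of `V` into `V[λ, μ]` as constant polynomials. -/
def const₂ : V →ₗ[k] (ℕ →₀ ℕ →₀ V) := const k (ℕ →₀ V) ∘ₗ const k V

/-- The action of `∂` on the coefficients of a polynomial. -/
def delPoly [Module k[X] V] [IsScalarTower k k[X] V] : Module.End k (ℕ →₀ V) :=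
  Finsupp.mapRange.linearMap (del k V)

variable {k V}

/-- Substitution of an operator for the variable: `∑ λ ^ n v_n ↦ ∑ T ^ n (φ v_n)`. -/
def subst {W : Type*} [AddCommGroup W] [Module k W] (φ : V →ₗ[k] W) (T : Module.End k W) :
    (ℕ →₀ V) →ₗ[k] W :=
  Finsupp.lsum k (fun n => (T ^ n) ∘ₗ φ)

end Poly

section LambdaMaps

variable (k : Type*) [Field k]
variable (U V W : Type*)
  [AddCommGroup U] [Module k U] [Module k[X] U] [IsScalarTower k k[X] U]
  [AddCommGroup V] [Module k V] [Module k[X] V] [IsScalarTower k k[X] V]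
  [AddCommGroup W] [Module k W] [Module k[X] W] [IsScalarTower k k[X] W]

/-- The `k`-bilinear maps `U × V → W[λ]`, `(a, b) ↦ a_λ b`, with `(∂ a)_λ b = -λ (a_λ b)` and
`a_λ (∂ b) = (∂ + λ) (a_λ b)`.  For `U = V = W` these are the `λ`-products (or `λ`-brackets) on `V`;
for `V = W` they are the `k[∂]`-module homomorphisms `U → gc(V) = Chom(V, V)`. -/
def LambdaMap : AddSubgroup (U →ₗ[k] V →ₗ[k] (ℕ →₀ W)) where
  carrier := {m | (∀ a b, m (del k U a) b = -var k W (m a b)) ∧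
    (∀ a b, m a (del k V b) = delPoly k W (m a b) + var k W (m a b))}
  add_mem' := by
    rintro m m' ⟨h1, h2⟩ ⟨h1', h2'⟩
    refine ⟨fun a b => ?_, fun a b => ?_⟩
    · simp only [LinearMap.add_apply, h1, h1', map_add]; abel
    · simp only [LinearMap.add_apply, h2, h2', map_add]; abel
  zero_mem' := by simp
  neg_mem' := by
    rintro m ⟨h1, h2⟩
    refine ⟨fun a b => ?_, fun a b => ?_⟩
    · simp only [LinearMap.neg_apply, h1, map_neg]
    · simp only [LinearMap.neg_apply, h2, map_neg, neg_add]

variable {k U V W}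

theorem subst_single {M N : Type*} [AddCommGroup M] [Module k M] [AddCommGroup N] [Module k N]
    (φ : M →ₗ[k] N) (T : Module.End k N) (n : ℕ) (v : M) :
    subst φ T (Finsupp.single n v) = (T ^ n) (φ v) := by
  simp [subst]

theorem var_single {M : Type*} [AddCommGroup M] [Module k M] (n : ℕ) (v : M) :
    var k M (Finsupp.single n v) = Finsupp.single (n + 1) v := by
  simp [var, Finsupp.lmapDomain_apply, Finsupp.mapDomain_single]

theorem map_var {M N : Type*} [AddCommGroup M] [Module k M] [AddCommGroup N] [Module k N]
    (f : M →ₗ[k] N) (w : ℕ →₀ M) :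
    Finsupp.mapRange.linearMap f (var k M w) = var k N (Finsupp.mapRange.linearMap f w) := by
  induction w using Finsupp.induction_linear with
  | zero => simp
  | add f g hf hg => simp only [map_add, hf, hg]
  | single n v => simp [var_single]

theorem delPoly_single (n : ℕ) (v : V) :
    delPoly k V (Finsupp.single n v) = Finsupp.single n (del k V v) := by
  simp [delPoly]

theorem delPoly_var (w : ℕ →₀ W) : delPoly k W (var k W w) = var k W (delPoly k W w) := by
  induction w using Finsupp.induction_linear with
  | zero => simp
  | add f g hf hg => simp only [map_add, hf, hg]
  | single n v => simp only [var_single, delPoly_single]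

variable (k W) in
/-- The substitution `λ ↦ -λ - ∂` on `W[λ]`. -/
def flipVar : Module.End k (ℕ →₀ W) := subst (const k W) (-var k W - delPoly k W)

theorem flipVar_var (w : ℕ →₀ W) :
    flipVar k W (var k W w) = -var k W (flipVar k W w) - delPoly k W (flipVar k W w) := by
  induction w using Finsupp.induction_linear with
  | zero => simp
  | add f g hf hg => simp only [map_add, hf, hg]; abel
  | single n v =>
    simp only [flipVar, var_single, subst_single, pow_succ', Module.End.mul_apply,
      LinearMap.sub_apply, LinearMap.neg_apply]

theorem flipVar_delPoly (w : ℕ →₀ W) :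
    flipVar k W (delPoly k W w) = delPoly k W (flipVar k W w) := by
  have hc : Commute (-var k W - delPoly k W) (delPoly k W) := by
    refine LinearMap.ext fun w => ?_
    simp only [Module.End.mul_apply, LinearMap.sub_apply, LinearMap.neg_apply, map_sub, map_neg,
      delPoly_var]
  induction w using Finsupp.induction_linear with
  | zero => simp
  | add f g hf hg => simp only [map_add, hf, hg]
  | single n v =>
    simp only [flipVar, delPoly_single, subst_single]
    have h1 : const k W (del k W v) = delPoly k W (const k W v) := by
      simp [const, delPoly_single]
    rw [h1, ← Module.End.mul_apply, (hc.pow_left n).eq, Module.End.mul_apply]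

/-- The opposite `(b, a) ↦ a_{-λ-∂} b` of `(a, b) ↦ a_λ b`. -/
def op (m : LambdaMap k U V W) : LambdaMap k V U W :=
  ⟨m.1.flip.compr₂ (flipVar k W), by
    refine ⟨fun b a => ?_, fun b a => ?_⟩
    · simp only [LinearMap.compr₂_apply, LinearMap.flip_apply, m.2.2, map_add, flipVar_var,
        flipVar_delPoly]
      abel
    · simp only [LinearMap.compr₂_apply, LinearMap.flip_apply, m.2.1, map_neg, flipVar_var]
      abel⟩

end LambdaMaps

/-! ### Poisson conformal algebras and pre-Poisson conformal algebras -/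

section Algebras

variable {k : Type*} [Field k]
variable {P : Type*} [AddCommGroup P] [Module k P] [Module k[X] P] [IsScalarTower k k[X] P]

/-- `a_S (b_T c) ∈ P[λ, μ]`, where the outer product is `m`, the inner one is `m'`, and `S`, `T` are
among `λ`, `μ`. -/
def nestR (m m' : LambdaMap k P P P) (S T : Module.End k (ℕ →₀ ℕ →₀ P)) (a b c : P) :
    ℕ →₀ ℕ →₀ P :=
  subst (subst (const₂ k P) S ∘ₗ m.1 a) T (m'.1 b c)

/-- `(a_S b)_T c ∈ P[λ, μ]`, where the inner product is `m`, the outer one is `m'`, and `S`, `T` are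
among `λ`, `μ`, `λ + μ`. -/
def nestL (m m' : LambdaMap k P P P) (S T : Module.End k (ℕ →₀ ℕ →₀ P)) (a b c : P) :
    ℕ →₀ ℕ →₀ P :=
  subst (subst (const₂ k P) T ∘ₗ m'.1.flip c) S (m.1 a b)

/-- Lie conformal algebra: skew-symmetry `[a_λ b] = -[b_{-λ-∂} a]` and the Jacobi identity
`[a_λ [b_μ c]] = [[a_λ b]_{λ+μ} c] + [b_μ [a_λ c]]`. -/
structure IsLieConformal (br : LambdaMap k P P P) : Prop where
  skew : br = -op br
  jacobi : ∀ a b c : P,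
    nestR br br (varL k P) (varM k P) a b c =
      nestL br br (varL k P) (varL k P + varM k P) a b c +
        nestR br br (varM k P) (varL k P) b a c

/-- Commutative associative conformal algebra: `a_λ b = b_{-λ-∂} a` and
`(a_λ b)_{λ+μ} c = a_λ (b_μ c)`. -/
structure IsCommAssocConformal (pr : LambdaMap k P P P) : Prop where
  comm : pr = op pr
  assoc : ∀ a b c : P,
    nestL pr pr (varL k P) (varL k P + varM k P) a b c =
      nestR pr pr (varL k P) (varM k P) a b c

/-- Poisson conformal algebra, with the Leibniz rule
`[a_λ (b_μ c)] = [a_λ b]_{λ+μ} c + b_μ [a_λ c]`. -/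
structure IsPoissonConformal (br pr : LambdaMap k P P P) : Prop where
  lie : IsLieConformal br
  commAssoc : IsCommAssocConformal pr
  leibniz : ∀ a b c : P,
    nestR br pr (varL k P) (varM k P) a b c =
      nestL br pr (varL k P) (varL k P + varM k P) a b c +
        nestR pr br (varM k P) (varL k P) b a c

/-- Left-symmetric conformal algebra:
`a ∘_λ (b ∘_μ c) - (a ∘_λ b) ∘_{λ+μ} c = b ∘_μ (a ∘_λ c) - (b ∘_μ a) ∘_{λ+μ} c`. -/
def IsLeftSymmetricConformal (ci : LambdaMap k P P P) : Prop :=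
  ∀ a b c : P,
    nestR ci ci (varL k P) (varM k P) a b c -
        nestL ci ci (varL k P) (varL k P + varM k P) a b c =
      nestR ci ci (varM k P) (varL k P) b a c -
        nestL ci ci (varM k P) (varL k P + varM k P) b a c

/-- Zinbiel conformal algebra:
`a ≻_λ (b ≻_μ c) = (a ≻_λ b + b ≻_{-λ-∂} a) ≻_{λ+μ} c`. -/
def IsZinbielConformal (su : LambdaMap k P P P) : Prop :=
  ∀ a b c : P,
    nestR su su (varL k P) (varM k P) a b c =
      nestL (su + op su) su (varL k P) (varL k P + varM k P) a b c

/-- Pre-Poisson conformal algebra `(P, ∘_λ, ≻_λ)`, with the compatibility conditions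
`(a ∘_λ b - b ∘_{-λ-∂} a) ≻_{λ+μ} c = a ∘_λ (b ≻_μ c) - b ≻_μ (a ∘_λ c)` and
`(a ≻_λ b + b ≻_{-λ-∂} a) ∘_{λ+μ} c = a ≻_λ (b ∘_μ c) + b ≻_μ (a ∘_λ c)`. -/
structure IsPrePoissonConformal (ci su : LambdaMap k P P P) : Prop where
  zinbiel : IsZinbielConformal su
  leftSymmetric : IsLeftSymmetricConformal ci
  compat₁ : ∀ a b c : P,
    nestL (ci - op ci) su (varL k P) (varL k P + varM k P) a b c =
      nestR ci su (varL k P) (varM k P) a b c - nestR su ci (varM k P) (varL k P) b a c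
  compat₂ : ∀ a b c : P,
    nestL (su + op su) ci (varL k P) (varL k P + varM k P) a b c =
      nestR su ci (varL k P) (varM k P) a b c + nestR su ci (varM k P) (varL k P) b a c

/-- The associated bracket `[a_λ b] = a ∘_λ b - b ∘_{-λ-∂} a`. -/
def assocBracket (ci : LambdaMap k P P P) : LambdaMap k P P P := ci - op ci

/-- The associated product `a_λ b = a ≻_λ b + b ≻_{-λ-∂} a`. -/
def assocProduct (su : LambdaMap k P P P) : LambdaMap k P P P := su + op su

end Algebras

/-! ### Semi-direct products -/

section SemiDirect

variable {k : Type*} [Field k]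
variable {P V : Type*}
  [AddCommGroup P] [Module k P] [Module k[X] P] [IsScalarTower k k[X] P]
  [AddCommGroup V] [Module k V] [Module k[X] V] [IsScalarTower k k[X] V]

/-- The `λ`-product `(a + x)_λ (b + y) = a_λ b + (l(a)_λ y + r(x)_λ b)` on `P ⊕ V`. -/
def semiDirect (m : LambdaMap k P P P) (l : LambdaMap k P V V) (r : LambdaMap k V P V) :
    LambdaMap k (P × V) (P × V) (P × V) :=
  ⟨LinearMap.mk₂ k
      (fun p q =>
        Finsupp.mapRange.linearMap (LinearMap.inl k P V) (m.1 p.1 q.1) +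
          Finsupp.mapRange.linearMap (LinearMap.inr k P V) (l.1 p.1 q.2 + r.1 p.2 q.1))
      (by intro p p' q
          simp only [Prod.fst_add, Prod.snd_add, map_add, LinearMap.add_apply]; abel)
      (by intro c p q
          simp only [Prod.smul_fst, Prod.smul_snd, map_smul, map_add, LinearMap.smul_apply,
            smul_add])
      (by intro p q q'
          simp only [Prod.fst_add, Prod.snd_add, map_add]; abel)
      (by intro c p q
          simp only [Prod.smul_fst, Prod.smul_snd, map_smul, map_add, smul_add]), by
    have hd1 : ∀ w : ℕ →₀ P, Finsupp.mapRange.linearMap (LinearMap.inl k P V) (delPoly k P w) =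
          delPoly k (P × V) (Finsupp.mapRange.linearMap (LinearMap.inl k P V) w) := by
      intro w
      ext n <;> simp [delPoly, del]
    have hd2 : ∀ w : ℕ →₀ V, Finsupp.mapRange.linearMap (LinearMap.inr k P V) (delPoly k V w) =
          delPoly k (P × V) (Finsupp.mapRange.linearMap (LinearMap.inr k P V) w) := by
      intro w
      ext n <;> simp [delPoly, del]
    have h1 : ∀ p : P × V, (del k (P × V) p).1 = del k P p.1 := fun p => rfl
    have h2 : ∀ p : P × V, (del k (P × V) p).2 = del k V p.2 := fun p => rfl
    refine ⟨fun p q => ?_, fun p q => ?_⟩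
    · simp only [LinearMap.mk₂_apply, h1, h2, m.2.1, l.2.1, r.2.1, map_add, map_neg, map_var]
      abel
    · simp only [LinearMap.mk₂_apply, h1, h2, m.2.2, l.2.2, r.2.2, map_add, map_var, hd1, hd2]
      abel⟩

/-- The bracket `[(a + x)_λ (b + y)] = [a_λ b] + ρ(a)_λ y - ρ(b)_{-λ-∂} x` of the semi-direct
product `P ⋉ V`. -/
def semiDirectBracket (br : LambdaMap k P P P) (ρ : LambdaMap k P V V) :
    LambdaMap k (P × V) (P × V) (P × V) :=
  semiDirect br ρ (-op ρ)

/-- The product `(a + x)_λ (b + y) = a_λ b + l(a)_λ y + l(b)_{-λ-∂} x` of the semi-direct product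
`P ⋉ V`. -/
def semiDirectProduct (pr : LambdaMap k P P P) (l : LambdaMap k P V V) :
    LambdaMap k (P × V) (P × V) (P × V) :=
  semiDirect pr l (op l)

end SemiDirect

/-! ### Conformal duals -/

section Dual

variable (k : Type*) [Field k]
variable (V : Type*) [AddCommGroup V] [Module k[X] V]

/-- The conformal dual `V^{*c}` of the `k[∂]`-module `V`: the `k`-linear maps `f : V → k[λ]` with
`f_λ (∂ b) = λ f_λ (b)`, that is, the maps `V → k[X]` linear over `k[X]`.  Its `k[∂]`-module
structure, given below, is not that of `V →ₗ[k[X]] k[X]`. -/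
def ConformalDual : Type _ := V →ₗ[k[X]] k[X]

namespace ConformalDual

instance : AddCommGroup (ConformalDual k V) := inferInstanceAs (AddCommGroup (V →ₗ[k[X]] k[X]))

instance : Module k (ConformalDual k V) := inferInstanceAs (Module k (V →ₗ[k[X]] k[X]))

/-- The `k[∂]`-module structure `(∂ f)_λ = -λ f_λ`. -/
instance : Module k[X] (ConformalDual k V) :=
  Module.compHom (V →ₗ[k[X]] k[X])
    (Polynomial.aeval (-Polynomial.X : k[X]) : k[X] →ₐ[k] k[X]).toRingHom

variable {k V}

/-- The value `f_λ (v) ∈ k[λ]`. -/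
def eval (f : ConformalDual k V) : V →ₗ[k[X]] k[X] := f

@[simp] theorem eval_add (f g : ConformalDual k V) (v : V) :
    (f + g).eval v = f.eval v + g.eval v := rfl

@[simp] theorem eval_neg (f : ConformalDual k V) (v : V) : (-f).eval v = -f.eval v := rfl

@[simp] theorem eval_smul (c : k) (f : ConformalDual k V) (v : V) :
    (c • f).eval v = c • f.eval v := rfl

@[simp] theorem eval_poly_smul (p : k[X]) (f : ConformalDual k V) (v : V) :
    (p • f).eval v = Polynomial.aeval (-Polynomial.X : k[X]) p * f.eval v := rfl

@[ext] theorem ext {f g : ConformalDual k V} (h : ∀ v, f.eval v = g.eval v) : f = g :=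
  LinearMap.ext h

instance : IsScalarTower k k[X] (ConformalDual k V) :=
  ⟨fun c p f => by ext1 v; simp⟩

theorem eval_del (f : ConformalDual k V) (v : V) :
    (del k (ConformalDual k V) f).eval v = -(Polynomial.X * f.eval v) := by
  simp [del]

end ConformalDual

end Dual

section DualAction

variable {k : Type*} [Field k]
variable {P V : Type*}
  [AddCommGroup P] [Module k P] [Module k[X] P] [IsScalarTower k k[X] P]
  [AddCommGroup V] [Module k V] [Module k[X] V] [IsScalarTower k k[X] V]

variable (k) in
/-- The ring homomorphism `k[X] → k[μ][λ]`, `p ↦ p(μ - λ)`. -/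
def shiftHom : k[X] →ₐ[k] k[X][X] :=
  Polynomial.aeval (Polynomial.C Polynomial.X - Polynomial.X : k[X][X])

/-- `f_{μ-λ} (w) ∈ k[μ][λ]` for `w ∈ V[λ]`: the sum `∑ λ ^ n f_{μ-λ} (w_n)`. -/
def pairShift (f : ConformalDual k V) : (ℕ →₀ V) →ₗ[k] k[X][X] :=
  Finsupp.lsum k (fun n =>
    LinearMap.mulLeft k ((Polynomial.X : k[X][X]) ^ n) ∘ₗ (shiftHom k).toLinearMap ∘ₗ
      (ConformalDual.eval f).restrictScalars k)

theorem pairShift_single (f : ConformalDual k V) (n : ℕ) (v : V) :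
    pairShift f (Finsupp.single n v) = Polynomial.X ^ n * shiftHom k (f.eval v) := by
  simp [pairShift]

theorem pairShift_var (f : ConformalDual k V) (w : ℕ →₀ V) :
    pairShift f (var k V w) = Polynomial.X * pairShift f w := by
  induction w using Finsupp.induction_linear with
  | zero => simp
  | add f g hf hg => simp only [map_add, hf, hg, mul_add]
  | single n v => simp only [var_single, pairShift_single]; ring

theorem pairShift_delPoly (f : ConformalDual k V) (w : ℕ →₀ V) :
    pairShift f (delPoly k V w) =
      (Polynomial.C Polynomial.X - Polynomial.X) * pairShift f w := by
  induction w using Finsupp.induction_linear with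
  | zero => simp
  | add f g hf hg => simp only [map_add, hf, hg, mul_add]
  | single n v =>
    have : del k V v = (Polynomial.X : k[X]) • v := rfl
    simp only [delPoly_single, pairShift_single, this, map_smul, smul_eq_mul, map_mul]
    simp only [shiftHom, Polynomial.aeval_X]; ring

/-- For an action `ρ`, the map `u ↦ -f_{μ-λ} (ρ(a)_λ u) ∈ k[μ][λ]`, which is linear over `k[μ]`
(`∂` acting on `V` as `μ`). -/
def dualPairing (ρ : LambdaMap k P V V) (a : P) (f : ConformalDual k V) :
    V →ₗ[k[X]] k[X][X] where
  toFun u := -pairShift f (ρ.1 a u)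
  map_add' u v := by simp only [map_add]; abel
  map_smul' p u := by
    induction p using Polynomial.induction_on' with
    | add p q hp hq =>
      simp only [add_smul, map_add, neg_add] at hp hq ⊢
      rw [hp, hq]
    | monomial n c =>
      have hX : ∀ u : V, -pairShift f (ρ.1 a ((Polynomial.X : k[X]) • u)) =
          (Polynomial.X : k[X]) • -pairShift f (ρ.1 a u) := by
        intro u
        have : (Polynomial.X : k[X]) • u = del k V u := rfl
        rw [this, ρ.2.2, map_add, pairShift_delPoly, pairShift_var, Polynomial.smul_eq_C_mul]
        ring
      have hn : ∀ (n : ℕ) (u : V), -pairShift f (ρ.1 a ((Polynomial.X ^ n : k[X]) • u)) =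
          (Polynomial.X ^ n : k[X]) • -pairShift f (ρ.1 a u) := by
        intro n
        induction n with
        | zero => intro u; simp
        | succ n ih => intro u; rw [pow_succ, mul_smul, ih, hX, mul_smul]
      have hm : (Polynomial.monomial n c : k[X]) = c • (Polynomial.X ^ n : k[X]) := by
        rw [← Polynomial.C_mul_X_pow_eq_monomial, Polynomial.smul_eq_C_mul]
      rw [hm, smul_assoc]
      simp only [map_smul, RingHom.id_apply]
      rw [smul_assoc, ← hn, smul_neg]

theorem dualPairing_apply (ρ : LambdaMap k P V V) (a : P) (f : ConformalDual k V) (u : V) :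
    dualPairing ρ a f u = -pairShift f (ρ.1 a u) := rfl

theorem finite_support_coeff {V : Type*} [AddCommGroup V] [Module k[X] V] [Module.Finite k[X] V]
    (F : V →ₗ[k[X]] k[X][X]) :
    (Function.support fun n => (Polynomial.lcoeff k[X] n ∘ₗ F : V →ₗ[k[X]] k[X])).Finite := by
  obtain ⟨S, hS⟩ := (Module.Finite.fg_top : (⊤ : Submodule k[X] V).FG)
  refine (S.biUnion fun s => (F s).support).finite_toSet.subset fun n hn => ?_
  by_contra hc
  refine hn (LinearMap.ext_on hS fun s hs => ?_)
  simp only [Finset.coe_biUnion, Set.mem_iUnion, not_exists] at hc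
  have := hc s hs
  simpa using this

/-- A `k[X]`-linear map `F : V → k[μ][λ]`, `V` finite, as a polynomial in `λ` whose coefficients are
functionals on `V`. -/
def coeffs [Module.Finite k[X] V] (F : V →ₗ[k[X]] k[X][X]) : ℕ →₀ ConformalDual k V :=
  Finsupp.ofSupportFinite
    (fun n => (Polynomial.lcoeff k[X] n ∘ₗ F : V →ₗ[k[X]] k[X])) (finite_support_coeff F)

theorem coeffs_apply [Module.Finite k[X] V] (F : V →ₗ[k[X]] k[X][X]) (n : ℕ) (u : V) :
    (coeffs F n).eval u = (F u).coeff n := rfl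

theorem pairShift_add (f g : ConformalDual k V) (w : ℕ →₀ V) :
    pairShift (f + g) w = pairShift f w + pairShift g w := by
  induction w using Finsupp.induction_linear with
  | zero => simp
  | add v w hv hw => simp only [map_add, hv, hw]; abel
  | single n v => simp [pairShift_single, mul_add]

theorem pairShift_smul (c : k) (f : ConformalDual k V) (w : ℕ →₀ V) :
    pairShift (c • f) w = c • pairShift f w := by
  induction w using Finsupp.induction_linear with
  | zero => simp
  | add v w hv hw => simp only [map_add, hv, hw, smul_add]
  | single n v => simp [pairShift_single]

theorem pairShift_del (f : ConformalDual k V) (w : ℕ →₀ V) :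
    pairShift (del k (ConformalDual k V) f) w =
      (Polynomial.X - Polynomial.C Polynomial.X) * pairShift f w := by
  induction w using Finsupp.induction_linear with
  | zero => simp
  | add v w hv hw => simp only [map_add, hv, hw, mul_add]
  | single n v =>
    simp only [pairShift_single, ConformalDual.eval_del, map_neg, map_mul]
    simp only [shiftHom, Polynomial.aeval_X]; ring

theorem var_eval_coeff {V : Type*} [AddCommGroup V] [Module k[X] V]
    (w : ℕ →₀ ConformalDual k V) (n : ℕ) (u : V) (p : k[X][X])
    (h : ∀ n, (w n).eval u = p.coeff n) :
    (var k (ConformalDual k V) w n).eval u = (Polynomial.X * p).coeff n := by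
  cases n with
  | zero =>
    have : var k (ConformalDual k V) w 0 = 0 := by
      rw [var, Finsupp.lmapDomain_apply]
      exact Finsupp.mapDomain_of_notMem_range _ _ (by simp)
    rw [this, Polynomial.coeff_X_mul_zero]; rfl
  | succ n =>
    have : var k (ConformalDual k V) w (n + 1) = w n := by
      rw [var, Finsupp.lmapDomain_apply]
      exact Finsupp.mapDomain_apply (add_left_injective 1) w n
    rw [this, Polynomial.coeff_X_mul, h]

/-- The dual `ρ* : P → gc(V^{*c})` of `ρ : P → gc(V)`, where `V` is a finite `k[∂]`-module, determined
by `(ρ*(a)_λ f)_μ u = -f_{μ-λ} (ρ(a)_λ u)`: the coefficient of `λ ^ n` in `ρ*(a)_λ f` is the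
functional that sends `u` to the coefficient of `λ ^ n` in `-f_{μ-λ} (ρ(a)_λ u)`. -/
def dualAction [Module.Finite k[X] V] (ρ : LambdaMap k P V V) :
    LambdaMap k P (ConformalDual k V) (ConformalDual k V) :=
  ⟨LinearMap.mk₂ k (fun a f => coeffs (dualPairing ρ a f))
      (by intro a a' f
          ext1 n; ext1 u
          simp only [Finsupp.add_apply, ConformalDual.eval_add, coeffs_apply, dualPairing_apply,
            map_add, LinearMap.add_apply, neg_add, Polynomial.coeff_add])
      (by intro c a f
          ext1 n; ext1 u
          simp only [Finsupp.smul_apply, ConformalDual.eval_smul, coeffs_apply, dualPairing_apply,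
            map_smul, LinearMap.smul_apply, ← smul_neg, Polynomial.coeff_smul])
      (by intro a f f'
          ext1 n; ext1 u
          simp only [Finsupp.add_apply, ConformalDual.eval_add, coeffs_apply, dualPairing_apply,
            pairShift_add, neg_add, Polynomial.coeff_add])
      (by intro c a f
          ext1 n; ext1 u
          simp only [Finsupp.smul_apply, ConformalDual.eval_smul, coeffs_apply, dualPairing_apply,
            pairShift_smul, ← smul_neg, Polynomial.coeff_smul]), by
    refine ⟨fun a f => ?_, fun a f => ?_⟩
    · ext1 n; ext1 u
      rw [LinearMap.mk₂_apply, LinearMap.mk₂_apply, Finsupp.neg_apply, ConformalDual.eval_neg,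
        var_eval_coeff _ n u (dualPairing ρ a f u) (fun _ => rfl), coeffs_apply,
        dualPairing_apply, dualPairing_apply, ρ.2.1, map_neg, pairShift_var, ← Polynomial.coeff_neg]
      congr 1; ring
    · ext1 n; ext1 u
      rw [LinearMap.mk₂_apply, LinearMap.mk₂_apply, Finsupp.add_apply, ConformalDual.eval_add,
        var_eval_coeff _ n u (dualPairing ρ a f u) (fun _ => rfl), coeffs_apply]
      have h : (delPoly k (ConformalDual k V) (coeffs (dualPairing ρ a f)) n).eval u =
          (-(Polynomial.C Polynomial.X * dualPairing ρ a f u)).coeff n := by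
        rw [delPoly, Finsupp.mapRange.linearMap_apply, Finsupp.mapRange_apply,
          ConformalDual.eval_del, coeffs_apply, Polynomial.coeff_neg, Polynomial.coeff_C_mul]
      rw [h, ← Polynomial.coeff_add, dualPairing_apply, dualPairing_apply, pairShift_del]
      congr 1; ring⟩

end DualAction

/-! ### The Poisson conformal Yang-Baxter equation -/

section YangBaxter

variable (k : Type*) [Field k]
variable (A : Type*) [AddCommGroup A] [Module k A] [Module k[X] A] [IsScalarTower k k[X] A]

/-- `∂ ⊗ I ⊗ I` on `A ⊗ A ⊗ A`. -/
def del₁ : Module.End k (A ⊗[k] (A ⊗[k] A)) := TensorProduct.map (del k A) LinearMap.id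

/-- `I ⊗ ∂ ⊗ I` on `A ⊗ A ⊗ A`. -/
def del₂ : Module.End k (A ⊗[k] (A ⊗[k] A)) :=
  TensorProduct.map LinearMap.id (TensorProduct.map (del k A) LinearMap.id)

/-- `I ⊗ I ⊗ ∂` on `A ⊗ A ⊗ A`. -/
def del₃ : Module.End k (A ⊗[k] (A ⊗[k] A)) :=
  TensorProduct.map LinearMap.id (TensorProduct.map LinearMap.id (del k A))

/-- `∂^{⊗3} = ∂ ⊗ I ⊗ I + I ⊗ ∂ ⊗ I + I ⊗ I ⊗ ∂`. -/
def delTensor₃ : Module.End k (A ⊗[k] (A ⊗[k] A)) := del₁ k A + del₂ k A + del₃ k A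

variable {k A}

/-- `(a ⊗ b) ⊗ t ↦ (m(a, b) ⊗ t)|_{μ = T}`, for `m : A × A → A[μ]` and an operator `T` on
`A ⊗ A ⊗ A`. -/
def slot₁ (m : A →ₗ[k] A →ₗ[k] (ℕ →₀ A)) (T : Module.End k (A ⊗[k] (A ⊗[k] A))) :
    (A ⊗[k] A) ⊗[k] (A ⊗[k] A) →ₗ[k] A ⊗[k] (A ⊗[k] A) :=
  subst LinearMap.id T ∘ₗ (TensorProduct.finsuppLeft k k A (A ⊗[k] A) ℕ).toLinearMap ∘ₗ
    TensorProduct.map (TensorProduct.lift m) LinearMap.id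

/-- `c ⊗ (a ⊗ b) ⊗ d ↦ (c ⊗ m(a, b) ⊗ d)|_{μ = T}`. -/
def slot₂ (m : A →ₗ[k] A →ₗ[k] (ℕ →₀ A)) (T : Module.End k (A ⊗[k] (A ⊗[k] A))) :
    A ⊗[k] ((A ⊗[k] A) ⊗[k] A) →ₗ[k] A ⊗[k] (A ⊗[k] A) :=
  subst LinearMap.id T ∘ₗ (TensorProduct.finsuppRight k k A (A ⊗[k] A) ℕ).toLinearMap ∘ₗ
    TensorProduct.map LinearMap.id ((TensorProduct.finsuppLeft k k A A ℕ).toLinearMap ∘ₗ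
      TensorProduct.map (TensorProduct.lift m) LinearMap.id)

/-- `c ⊗ d ⊗ (a ⊗ b) ↦ (c ⊗ d ⊗ m(a, b))|_{μ = T}`. -/
def slot₃ (m : A →ₗ[k] A →ₗ[k] (ℕ →₀ A)) (T : Module.End k (A ⊗[k] (A ⊗[k] A))) :
    A ⊗[k] (A ⊗[k] (A ⊗[k] A)) →ₗ[k] A ⊗[k] (A ⊗[k] A) :=
  subst LinearMap.id T ∘ₗ (TensorProduct.finsuppRight k k A (A ⊗[k] A) ℕ).toLinearMap ∘ₗ
    TensorProduct.map LinearMap.id ((TensorProduct.finsuppRight k k A A ℕ).toLinearMap ∘ₗ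
      TensorProduct.map LinearMap.id (TensorProduct.lift m))

theorem slot₁_tmul {A : Type*} [AddCommGroup A] [Module k A]
    (m : A →ₗ[k] A →ₗ[k] (ℕ →₀ A)) (T : Module.End k (A ⊗[k] (A ⊗[k] A)))
    (a b : A) (t : A ⊗[k] A) :
    slot₁ m T ((a ⊗ₜ b) ⊗ₜ t) = (m a b).sum fun n v => (T ^ n) (v ⊗ₜ t) := by
  simp only [slot₁, LinearMap.comp_apply, TensorProduct.map_tmul, TensorProduct.lift.tmul,
    LinearMap.id_apply]
  generalize m a b = w
  induction w using Finsupp.induction_linear with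
  | zero => simp
  | add f g hf hg =>
    rw [TensorProduct.add_tmul, map_add, map_add, hf, hg, Finsupp.sum_add_index'] <;>
      simp [TensorProduct.add_tmul]
  | single n v =>
    simp [TensorProduct.finsuppLeft_apply_tmul, subst_single]

theorem slot₂_tmul {A : Type*} [AddCommGroup A] [Module k A]
    (m : A →ₗ[k] A →ₗ[k] (ℕ →₀ A)) (T : Module.End k (A ⊗[k] (A ⊗[k] A)))
    (a b c d : A) :
    slot₂ m T (c ⊗ₜ ((a ⊗ₜ b) ⊗ₜ d)) = (m a b).sum fun n v => (T ^ n) (c ⊗ₜ (v ⊗ₜ d)) := by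
  simp only [slot₂, LinearMap.comp_apply, TensorProduct.map_tmul, TensorProduct.lift.tmul,
    LinearMap.id_apply]
  generalize m a b = w
  induction w using Finsupp.induction_linear with
  | zero => simp
  | add f g hf hg =>
    rw [TensorProduct.add_tmul, map_add, TensorProduct.tmul_add, map_add, map_add, hf, hg,
      Finsupp.sum_add_index'] <;>
      simp [TensorProduct.add_tmul, TensorProduct.tmul_add]
  | single n v =>
    simp [TensorProduct.finsuppLeft_apply_tmul, TensorProduct.finsuppRight_apply_tmul,
      subst_single]

theorem slot₃_tmul {A : Type*} [AddCommGroup A] [Module k A]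
    (m : A →ₗ[k] A →ₗ[k] (ℕ →₀ A)) (T : Module.End k (A ⊗[k] (A ⊗[k] A)))
    (a b c d : A) :
    slot₃ m T (c ⊗ₜ (d ⊗ₜ (a ⊗ₜ b))) = (m a b).sum fun n v => (T ^ n) (c ⊗ₜ (d ⊗ₜ v)) := by
  simp only [slot₃, LinearMap.comp_apply, TensorProduct.map_tmul, TensorProduct.lift.tmul,
    LinearMap.id_apply]
  generalize m a b = w
  induction w using Finsupp.induction_linear with
  | zero => simp
  | add f g hf hg =>
    rw [TensorProduct.tmul_add, map_add, TensorProduct.tmul_add, map_add, map_add, hf, hg,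
      Finsupp.sum_add_index'] <;>
      simp [TensorProduct.tmul_add]
  | single n v =>
    simp [TensorProduct.finsuppRight_apply_tmul, subst_single]

variable (k A) in
/-- `(a ⊗ b) ⊗ (c ⊗ d) ↦ (a ⊗ c) ⊗ (b ⊗ d)`. -/
def perm₁ : (A ⊗[k] A) ⊗[k] (A ⊗[k] A) →ₗ[k] (A ⊗[k] A) ⊗[k] (A ⊗[k] A) :=
  (TensorProduct.tensorTensorTensorComm k A A A A).toLinearMap

variable (k A) in
/-- `(a ⊗ b) ⊗ (c ⊗ d) ↦ a ⊗ (b ⊗ c) ⊗ d`. -/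
def perm₂ : (A ⊗[k] A) ⊗[k] (A ⊗[k] A) →ₗ[k] A ⊗[k] ((A ⊗[k] A) ⊗[k] A) :=
  TensorProduct.map LinearMap.id (TensorProduct.assoc k A A A).symm.toLinearMap ∘ₗ
    (TensorProduct.assoc k A A (A ⊗[k] A)).toLinearMap

variable (k A) in
/-- `(a ⊗ b) ⊗ (c ⊗ d) ↦ a ⊗ c ⊗ (b ⊗ d)`. -/
def perm₃ : (A ⊗[k] A) ⊗[k] (A ⊗[k] A) →ₗ[k] A ⊗[k] (A ⊗[k] (A ⊗[k] A)) :=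
  (TensorProduct.assoc k A A (A ⊗[k] A)).toLinearMap ∘ₗ perm₁ k A

/-- `[[r, r]]`, which for `r = ∑ r_i ⊗ l_i` is the sum over `i`, `j` of
`[r_i _μ r_j] ⊗ l_i ⊗ l_j |_{μ = I ⊗ ∂ ⊗ I} - r_i ⊗ [r_j _μ l_i] ⊗ l_j |_{μ = I ⊗ I ⊗ ∂}
  - r_i ⊗ r_j ⊗ [l_j _μ l_i] |_{μ = I ⊗ ∂ ⊗ I}`. -/
def doubleBracket (br : LambdaMap k A A A) (r : A ⊗[k] A) : A ⊗[k] (A ⊗[k] A) :=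
  slot₁ br.1 (del₂ k A) (perm₁ k A (r ⊗ₜ r)) -
    slot₂ br.1.flip (del₃ k A) (perm₂ k A (r ⊗ₜ r)) -
    slot₃ br.1.flip (del₂ k A) (perm₃ k A (r ⊗ₜ r))

/-- `r • r`, which for `r = ∑ r_i ⊗ l_i` is the sum over `i`, `j` of
`r_i ⊗ r_j ⊗ (l_i _μ l_j) |_{μ = ∂ ⊗ I ⊗ I} - r_i ⊗ (r_j _μ l_i) ⊗ l_j |_{μ = -∂^{⊗2} ⊗ I}
  + (r_i _μ r_j) ⊗ l_i ⊗ l_j |_{μ = I ⊗ ∂ ⊗ I}`, where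
`∂^{⊗2} ⊗ I = ∂ ⊗ I ⊗ I + I ⊗ ∂ ⊗ I`. -/
def bulletSquare (pr : LambdaMap k A A A) (r : A ⊗[k] A) : A ⊗[k] (A ⊗[k] A) :=
  slot₃ pr.1 (del₁ k A) (perm₃ k A (r ⊗ₜ r)) -
    slot₂ pr.1.flip (-(del₁ k A + del₂ k A)) (perm₂ k A (r ⊗ₜ r)) +
    slot₁ pr.1 (del₂ k A) (perm₁ k A (r ⊗ₜ r))

/-- The displayed formula for `[[r, r]]`. -/
theorem doubleBracket_sum {ι : Type*} [Fintype ι] (br : LambdaMap k A A A) (r l : ι → A) :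
    doubleBracket br (∑ i, r i ⊗ₜ l i) =
      ∑ i, ∑ j,
        (((br.1 (r i) (r j)).sum fun n v => (del₂ k A ^ n) (v ⊗ₜ (l i ⊗ₜ l j))) -
          ((br.1 (r j) (l i)).sum fun n v => (del₃ k A ^ n) (r i ⊗ₜ (v ⊗ₜ l j))) -
          ((br.1 (l j) (l i)).sum fun n v => (del₂ k A ^ n) (r i ⊗ₜ (r j ⊗ₜ v)))) := by
  simp only [doubleBracket, TensorProduct.sum_tmul, TensorProduct.tmul_sum, map_sum,
    Finset.sum_sub_distrib]
  simp only [perm₁, perm₂, perm₃, LinearMap.comp_apply, LinearEquiv.coe_coe,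
    TensorProduct.tensorTensorTensorComm_tmul, TensorProduct.assoc_tmul, TensorProduct.map_tmul,
    TensorProduct.assoc_symm_tmul, LinearMap.id_apply, slot₁_tmul, slot₂_tmul, slot₃_tmul,
    LinearMap.flip_apply]
  congr 1
  · congr 1 <;> exact Finset.sum_comm
  · exact Finset.sum_comm

/-- The displayed formula for `r • r`. -/
theorem bulletSquare_sum {ι : Type*} [Fintype ι] (pr : LambdaMap k A A A) (r l : ι → A) :
    bulletSquare pr (∑ i, r i ⊗ₜ l i) =
      ∑ i, ∑ j,
        (((pr.1 (l i) (l j)).sum fun n v => (del₁ k A ^ n) (r i ⊗ₜ (r j ⊗ₜ v))) -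
          ((pr.1 (r j) (l i)).sum fun n v =>
            ((-(del₁ k A + del₂ k A)) ^ n) (r i ⊗ₜ (v ⊗ₜ l j))) +
          ((pr.1 (r i) (r j)).sum fun n v => (del₂ k A ^ n) (v ⊗ₜ (l i ⊗ₜ l j)))) := by
  simp only [bulletSquare, TensorProduct.sum_tmul, TensorProduct.tmul_sum, map_sum,
    Finset.sum_sub_distrib, Finset.sum_add_distrib]
  simp only [perm₁, perm₂, perm₃, LinearMap.comp_apply, LinearEquiv.coe_coe,
    TensorProduct.tensorTensorTensorComm_tmul, TensorProduct.assoc_tmul, TensorProduct.map_tmul,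
    TensorProduct.assoc_symm_tmul, LinearMap.id_apply, slot₁_tmul, slot₂_tmul, slot₃_tmul,
    LinearMap.flip_apply]
  congr 1
  · congr 1 <;> exact Finset.sum_comm
  · exact Finset.sum_comm

/-- `r` is a solution of the Poisson conformal Yang-Baxter equation in the Poisson conformal algebra
`(A, br, pr)`: both `[[r, r]]` and `r • r` vanish modulo the image of `∂^{⊗3}`. -/
structure IsPCYBESolution (br pr : LambdaMap k A A A) (r : A ⊗[k] A) : Prop where
  poisson : IsPoissonConformal br pr
  lie_eq : doubleBracket br r ∈ LinearMap.range (delTensor₃ k A)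
  assoc_eq : bulletSquare pr r ∈ LinearMap.range (delTensor₃ k A)

end YangBaxter

section CanonicalElement

variable {k : Type*} [Field k]
variable {P : Type*} [AddCommGroup P] [Module k P] [Module k[X] P] [IsScalarTower k k[X] P]

/-- The element `e_i^*` of the dual `k[∂]`-basis: `(e_i^*)_λ (e_j) = δ_{ij}`. -/
def dualBasis {n : ℕ} (e : Module.Basis (Fin n) k[X] P) (i : Fin n) : ConformalDual k P := e.coord i

/-- `r = ∑ (e_i ⊗ e_i^* - e_i^* ⊗ e_i)` in `(P ⊕ P^{*c}) ⊗ (P ⊕ P^{*c})`. -/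
def canonicalElement {n : ℕ} (e : Module.Basis (Fin n) k[X] P) :
    (P × ConformalDual k P) ⊗[k] (P × ConformalDual k P) :=
  ∑ i, (((e i, 0) : P × ConformalDual k P) ⊗ₜ[k] ((0, dualBasis e i) : P × ConformalDual k P) -
    ((0, dualBasis e i) : P × ConformalDual k P) ⊗ₜ[k] ((e i, 0) : P × ConformalDual k P))

end CanonicalElement

end PoissonConformal

end

open PoissonConformal

noncomputable section

namespace PoissonConformal

/-! ### Substitution -/

section Subst

variable {k : Type*} [Field k]
variable {V W Q Q' : Type*} [AddCommGroup V] [Module k V] [AddCommGroup W] [Module k W]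
  [AddCommGroup Q] [Module k Q] [AddCommGroup Q'] [Module k Q']

/-! The semi-direct product `A = P ⊕ P^{*c}` comes itself from a pre-Poisson conformal structure:
keep `∘` and `≻` on `P`, let `P` multiply the dual from the left through the dual action of `∘` and
minus the dual action of `≻`, and let the dual multiply everything from the left by zero. Its axioms
on the dual component are the axioms of `P` transposed
(`IsPrePoissonConformal.semiDirect_dualAction`), and its associated bracket and product are those of
the semi-direct product (`assocBracket_semiDirect`, `assocProduct_semiDirect`). So the one statement
`IsPrePoissonConformal.isPoissonConformal` yields both Poisson claims.

Identities in `λ`, `μ` are handled by evaluation: coefficients are mapped to a vector space `Q` and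
the variables are replaced by commuting operators `S`, `T`. If `∂` becomes `D` and `N` is chosen
with `D + S + T + N = 0`, then `S`, `T`, `N` belong to the three factors, and sesquilinearity turns
the passage to an opposite product into a permutation of the factors. The Poisson axioms then follow
from linear relations between nested products, exactly as for ordinary pre-Poisson algebras.

For the Yang–Baxter equation, work in `A ⊗ A ⊗ A` modulo the image of `∂^{⊗3}`, where the three
copies of `∂` have sum zero. The element `r = ∑ r_i ⊗ l_i` is skew-symmetric, and it is invariant up
to sign under left multiplication because the pairing of `P` with its dual is
(`sum_subst_dualAction`, `isInvariant_canonical`). Splitting the bracket or product into a left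
product and its opposite gives six double sums, two for each copy of `∂`. Invariance, helped once by
skew-symmetry, cancels each pair (`IsEquivariant.sum_bracket_eq_zero`,
`IsEquivariant.sum_bullet_eq_zero`). -/

theorem subst_const (φ : V →ₗ[k] Q) (T : Module.End k Q) (v : V) :
    subst φ T (const k V v) = φ v := by
  simp [const, subst_single]

theorem subst_var (φ : V →ₗ[k] Q) (T : Module.End k Q) (w : ℕ →₀ V) :
    subst φ T (var k V w) = T (subst φ T w) := by
  induction w using Finsupp.induction_linear with
  | zero => simp
  | add f g hf hg => simp only [map_add, hf, hg]
  | single n v => simp only [var_single, subst_single, pow_succ', Module.End.mul_apply]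

theorem apply_pow_of_semiconj {F : Q →ₗ[k] Q'} {T : Module.End k Q} {T' : Module.End k Q'}
    (h : ∀ x, F (T x) = T' (F x)) (n : ℕ) (x : Q) : F ((T ^ n) x) = (T' ^ n) (F x) := by
  induction n generalizing x with
  | zero => rfl
  | succ n ih => rw [pow_succ, pow_succ, Module.End.mul_apply, Module.End.mul_apply, ih, h]

theorem map_subst (F : Q →ₗ[k] Q') (φ : V →ₗ[k] Q) {T : Module.End k Q} {T' : Module.End k Q'}
    (h : ∀ x, F (T x) = T' (F x)) (w : ℕ →₀ V) :
    F (subst φ T w) = subst (F ∘ₗ φ) T' w := by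
  induction w using Finsupp.induction_linear with
  | zero => simp
  | add f g hf hg => simp only [map_add, hf, hg]
  | single n v =>
    simp only [subst_single, LinearMap.comp_apply, apply_pow_of_semiconj h]

theorem subst_mapRange (φ : W →ₗ[k] Q) (T : Module.End k Q) (g : V →ₗ[k] W) (w : ℕ →₀ V) :
    subst φ T (Finsupp.mapRange.linearMap g w) = subst (φ ∘ₗ g) T w := by
  induction w using Finsupp.induction_linear with
  | zero => simp
  | add f g hf hg => simp only [map_add, hf, hg]
  | single n v => simp [subst_single]

theorem subst_add (φ ψ : V →ₗ[k] Q) (T : Module.End k Q) :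
    subst (φ + ψ) T = subst φ T + subst ψ T := by
  ext; simp [subst]

theorem subst_neg (φ : V →ₗ[k] Q) (T : Module.End k Q) : subst (-φ) T = -subst φ T := by
  ext; simp [subst]

theorem subst_zero (T : Module.End k Q) : subst (0 : V →ₗ[k] Q) T = 0 := by
  ext; simp [subst]

theorem subst_sum {ι : Type*} (s : Finset ι) (φ : ι → V →ₗ[k] Q) (T : Module.End k Q) :
    subst (∑ i ∈ s, φ i) T = ∑ i ∈ s, subst (φ i) T := by
  ext; simp [subst]

theorem subst_eq_sum (φ : V →ₗ[k] Q) (T : Module.End k Q) (w : ℕ →₀ V) :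
    subst φ T w = w.sum fun n v => (T ^ n) (φ v) := rfl

/-- Two substitutions of commuting operators into a bilinear map can be interchanged. -/
theorem subst_comm (B : V →ₗ[k] W →ₗ[k] Q) {S T : Module.End k Q} (h : Commute S T)
    {φ : V →ₗ[k] Q} {ψ : W →ₗ[k] Q} {v : ℕ →₀ V} {w : ℕ →₀ W}
    (hφ : ∀ x, φ x = subst (B x) S w) (hψ : ∀ y, ψ y = subst (B.flip y) T v) :
    subst φ T v = subst ψ S w := by
  simp only [subst_eq_sum, hφ, hψ, Finsupp.sum, map_sum]
  rw [Finset.sum_comm]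
  refine Finset.sum_congr rfl fun i _ => Finset.sum_congr rfl fun j _ => ?_
  exact LinearMap.congr_fun (h.pow_pow i j).eq.symm _

variable [Module k[X] V] [IsScalarTower k k[X] V]

theorem subst_delPoly {φ : V →ₗ[k] Q} {D T : Module.End k Q} (hφ : ∀ v, φ (del k V v) = D (φ v))
    (h : Commute D T) (w : ℕ →₀ V) : subst φ T (delPoly k V w) = D (subst φ T w) := by
  have h' : ∀ x, D (T x) = T (D x) := fun x => LinearMap.congr_fun h.eq x
  rw [map_subst D φ h', delPoly, subst_mapRange]
  congr 2
  exact LinearMap.ext hφ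

/-- This is the source of every rule for opposite products: once `∂` is represented by an operator
`D` commuting with `T`, the substitution `λ ↦ -λ - ∂` merely changes the point of evaluation. -/
theorem subst_flipVar {φ : V →ₗ[k] Q} {D T : Module.End k Q} (hφ : ∀ v, φ (del k V v) = D (φ v))
    (h : Commute D T) (w : ℕ →₀ V) : subst φ T (flipVar k V w) = subst φ (-T - D) w := by
  rw [flipVar, map_subst (subst φ T) (const k V) (T' := -T - D)]
  · congr 2
    exact LinearMap.ext (subst_const φ T)
  · intro x
    simp only [LinearMap.sub_apply, LinearMap.neg_apply, map_sub, map_neg, subst_var,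
      subst_delPoly hφ h]

/-- A `k`-linear map that intertwines `∂` with `D` turns the action of `p(∂)` into
that of `p(D)`. -/
theorem apply_poly_smul {φ : V →ₗ[k] Q} {D : Module.End k Q} (hφ : ∀ v, φ (del k V v) = D (φ v))
    (p : k[X]) (v : V) : φ (p • v) = Polynomial.aeval D p (φ v) := by
  induction p using Polynomial.induction_on' with
  | add p q hp hq => simp only [add_smul, map_add, hp, hq, LinearMap.add_apply]
  | monomial n c =>
    have hn : (Polynomial.monomial n c : k[X]) • v = c • (del k V ^ n) v := by
      rw [← Polynomial.C_mul_X_pow_eq_monomial, ← Polynomial.smul_eq_C_mul, smul_assoc, del,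
        ← map_pow, Algebra.lsmul_coe]
    rw [hn, map_smul, apply_pow_of_semiconj hφ, ← Polynomial.C_mul_X_pow_eq_monomial]
    simp [Algebra.algebraMap_eq_smul_one]

end Subst

/-! ### Nested products with values in a module -/

section Nest

variable {k : Type*} [Field k]

section Raw

variable {U V W U' V' Q Q' : Type*} [AddCommGroup U] [Module k U] [AddCommGroup V] [Module k V]
  [AddCommGroup W] [Module k W] [AddCommGroup U'] [Module k U'] [AddCommGroup V'] [Module k V']
  [AddCommGroup Q] [Module k Q] [AddCommGroup Q'] [Module k Q']

/-- The image of `a_S (b_T c)` under `φ`. -/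
def evalR (φ : W →ₗ[k] Q) (S T : Module.End k Q) (m : U →ₗ[k] V →ₗ[k] (ℕ →₀ W))
    (m' : U' →ₗ[k] V' →ₗ[k] (ℕ →₀ V)) (a : U) (b : U') (c : V') : Q :=
  subst (subst φ S ∘ₗ m a) T (m' b c)

/-- The image of `(a_S b)_T c` under `φ`. -/
def evalL (φ : W →ₗ[k] Q) (S T : Module.End k Q) (m : U' →ₗ[k] V' →ₗ[k] (ℕ →₀ U))
    (m' : U →ₗ[k] V →ₗ[k] (ℕ →₀ W)) (a : U') (b : V') (c : V) : Q :=
  subst (subst φ T ∘ₗ m'.flip c) S (m a b)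

theorem map_evalR (F : Q →ₗ[k] Q') (φ : W →ₗ[k] Q) {S T : Module.End k Q} {S' T' : Module.End k Q'}
    (hS : ∀ x, F (S x) = S' (F x)) (hT : ∀ x, F (T x) = T' (F x))
    (m : U →ₗ[k] V →ₗ[k] (ℕ →₀ W)) (m' : U' →ₗ[k] V' →ₗ[k] (ℕ →₀ V))
    (a : U) (b : U') (c : V') :
    F (evalR φ S T m m' a b c) = evalR (F ∘ₗ φ) S' T' m m' a b c := by
  rw [evalR, evalR, map_subst F _ hT]
  congr 2
  exact LinearMap.ext fun v => map_subst F φ hS _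

theorem map_evalL (F : Q →ₗ[k] Q') (φ : W →ₗ[k] Q) {S T : Module.End k Q} {S' T' : Module.End k Q'}
    (hS : ∀ x, F (S x) = S' (F x)) (hT : ∀ x, F (T x) = T' (F x))
    (m : U' →ₗ[k] V' →ₗ[k] (ℕ →₀ U)) (m' : U →ₗ[k] V →ₗ[k] (ℕ →₀ W))
    (a : U') (b : V') (c : V) :
    F (evalL φ S T m m' a b c) = evalL (F ∘ₗ φ) S' T' m m' a b c := by
  rw [evalL, evalL, map_subst F _ hS]
  congr 2
  exact LinearMap.ext fun v => map_subst F φ hT _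

end Raw

/-! ### Polynomials in two variables at commuting operators. -/

section Operators

variable {V Q : Type*} [AddCommGroup V] [Module k V] [AddCommGroup Q] [Module k Q]

/-- The image of a polynomial in `λ`, `μ` under `φ` on coefficients and `λ ↦ S`, `μ ↦ T`. -/
def subst₂ (φ : V →ₗ[k] Q) (S T : Module.End k Q) : (ℕ →₀ ℕ →₀ V) →ₗ[k] Q :=
  subst (subst φ T) S

theorem subst₂_varL (φ : V →ₗ[k] Q) (S T : Module.End k Q) (w : ℕ →₀ ℕ →₀ V) :
    subst₂ φ S T (varL k V w) = S (subst₂ φ S T w) := subst_var _ _ _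

theorem subst₂_varM (φ : V →ₗ[k] Q) {S T : Module.End k Q} (h : Commute S T) (w : ℕ →₀ ℕ →₀ V) :
    subst₂ φ S T (varM k V w) = T (subst₂ φ S T w) := by
  rw [subst₂, varM, subst_mapRange, map_subst T (subst φ T) fun x =>
    (LinearMap.congr_fun h.eq x).symm]
  congr 2
  exact LinearMap.ext (subst_var φ T)

theorem subst₂_const₂ (φ : V →ₗ[k] Q) (S T : Module.End k Q) :
    subst₂ φ S T ∘ₗ const₂ k V = φ := by
  ext v
  simp only [subst₂, const₂, LinearMap.comp_apply, subst_const]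

theorem subst₂_varL_add_varM (φ : V →ₗ[k] Q) {S T : Module.End k Q} (h : Commute S T)
    (w : ℕ →₀ ℕ →₀ V) :
    subst₂ φ S T ((varL k V + varM k V) w) = (S + T) (subst₂ φ S T w) := by
  rw [LinearMap.add_apply, map_add, subst₂_varL, subst₂_varM φ h, LinearMap.add_apply]

theorem commute_varL_varM : Commute (varL k V) (varM k V) :=
  LinearMap.ext fun w => (map_var (var k V) w).symm

variable [Module k[X] V] [IsScalarTower k k[X] V]

variable (k V) in
/-- The action of `∂` on the coefficients of a polynomial in two variables. -/
def delPoly₂ : Module.End k (ℕ →₀ ℕ →₀ V) := Finsupp.mapRange.linearMap (delPoly k V)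

theorem commute_delPoly₂_varL : Commute (delPoly₂ k V) (varL k V) :=
  LinearMap.ext fun w => map_var (delPoly k V) w

theorem commute_delPoly₂_varM : Commute (delPoly₂ k V) (varM k V) := by
  refine LinearMap.ext fun w => Finsupp.ext fun n => ?_
  simp [delPoly₂, varM, delPoly_var]

theorem const₂_del (v : V) : const₂ k V (del k V v) = delPoly₂ k V (const₂ k V v) := by
  simp [const₂, const, delPoly₂, delPoly]

end Operators

section Linearity

variable {U V W U' V' Q : Type*}
  [AddCommGroup U] [Module k U] [Module k[X] U] [IsScalarTower k k[X] U]
  [AddCommGroup V] [Module k V] [Module k[X] V] [IsScalarTower k k[X] V]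
  [AddCommGroup W] [Module k W] [Module k[X] W] [IsScalarTower k k[X] W]
  [AddCommGroup U'] [Module k U'] [Module k[X] U'] [IsScalarTower k k[X] U']
  [AddCommGroup V'] [Module k V'] [Module k[X] V'] [IsScalarTower k k[X] V']
  [AddCommGroup Q] [Module k Q]
  (φ : W →ₗ[k] Q) (S T : Module.End k Q)

theorem evalR_add_left (m₁ m₂ : LambdaMap k U V W) (m : LambdaMap k U' V' V)
    (a : U) (b : U') (c : V') :
    evalR φ S T (m₁ + m₂).1 m.1 a b c =
    evalR φ S T m₁.1 m.1 a b c + evalR φ S T m₂.1 m.1 a b c := by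
  simp only [evalR, AddSubgroup.coe_add, LinearMap.add_apply, LinearMap.comp_add, subst_add]

theorem evalR_add_right (m : LambdaMap k U V W) (m₁ m₂ : LambdaMap k U' V' V)
    (a : U) (b : U') (c : V') :
    evalR φ S T m.1 (m₁ + m₂).1 a b c =
    evalR φ S T m.1 m₁.1 a b c + evalR φ S T m.1 m₂.1 a b c := by
  simp only [evalR, AddSubgroup.coe_add, LinearMap.add_apply, map_add]

theorem evalR_neg_left (m₁ : LambdaMap k U V W) (m : LambdaMap k U' V' V)
    (a : U) (b : U') (c : V') :
    evalR φ S T (-m₁).1 m.1 a b c = -evalR φ S T m₁.1 m.1 a b c := by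
  simp only [evalR, NegMemClass.coe_neg, LinearMap.neg_apply, LinearMap.comp_neg, subst_neg]

theorem evalR_neg_right (m : LambdaMap k U V W) (m₁ : LambdaMap k U' V' V)
    (a : U) (b : U') (c : V') :
    evalR φ S T m.1 (-m₁).1 a b c = -evalR φ S T m.1 m₁.1 a b c := by
  simp only [evalR, NegMemClass.coe_neg, LinearMap.neg_apply, map_neg]

theorem evalL_add_left (m₁ m₂ : LambdaMap k U' V' U) (m : LambdaMap k U V W)
    (a : U') (b : V') (c : V) :
    evalL φ S T (m₁ + m₂).1 m.1 a b c =
    evalL φ S T m₁.1 m.1 a b c + evalL φ S T m₂.1 m.1 a b c := by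
  simp only [evalL, AddSubgroup.coe_add, LinearMap.add_apply, map_add]

theorem flip_add' {U V W : Type*} [AddCommGroup U] [Module k U] [AddCommGroup V] [Module k V]
    [AddCommGroup W] [Module k W] (f g : U →ₗ[k] V →ₗ[k] W) : (f + g).flip = f.flip + g.flip := rfl

theorem evalL_add_right (m : LambdaMap k U' V' U) (m₁ m₂ : LambdaMap k U V W)
    (a : U') (b : V') (c : V) :
    evalL φ S T m.1 (m₁ + m₂).1 a b c =
    evalL φ S T m.1 m₁.1 a b c + evalL φ S T m.1 m₂.1 a b c := by
  simp only [evalL, AddSubgroup.coe_add, flip_add', LinearMap.add_apply, LinearMap.comp_add,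
    subst_add]

theorem evalL_neg_left (m₁ : LambdaMap k U' V' U) (m : LambdaMap k U V W)
    (a : U') (b : V') (c : V) :
    evalL φ S T (-m₁).1 m.1 a b c = -evalL φ S T m₁.1 m.1 a b c := by
  simp only [evalL, NegMemClass.coe_neg, LinearMap.neg_apply, map_neg]

theorem flip_neg' {U V W : Type*} [AddCommGroup U] [Module k U] [AddCommGroup V] [Module k V]
    [AddCommGroup W] [Module k W] (f : U →ₗ[k] V →ₗ[k] W) : (-f).flip = -f.flip := rfl

theorem evalL_neg_right (m : LambdaMap k U' V' U) (m₁ : LambdaMap k U V W)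
    (a : U') (b : V') (c : V) :
    evalL φ S T m.1 (-m₁).1 a b c = -evalL φ S T m.1 m₁.1 a b c := by
  simp only [evalL, NegMemClass.coe_neg, flip_neg', LinearMap.neg_apply, LinearMap.comp_neg,
    subst_neg]

end Linearity

/-! ### Specialization of nested products, and opposite products as permutations of factors. -/

section Rules

variable {P Q : Type*} [AddCommGroup P] [Module k P] [Module k[X] P] [IsScalarTower k k[X] P]
  [AddCommGroup Q] [Module k Q]

theorem nestR_eq (m m' : LambdaMap k P P P) (S T : Module.End k (ℕ →₀ ℕ →₀ P)) (a b c : P) :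
    nestR m m' S T a b c = evalR (const₂ k P) S T m.1 m'.1 a b c := rfl

theorem nestL_eq (m m' : LambdaMap k P P P) (a b c : P) :
    nestL m m' (varL k P) (varL k P + varM k P) a b c =
      evalL (const₂ k P) (varL k P) (varL k P + varM k P) m.1 m'.1 a b c := rfl

theorem nestL_swap_eq (m m' : LambdaMap k P P P) (a b c : P) :
    nestL m m' (varM k P) (varL k P + varM k P) a b c =
      evalL (const₂ k P) (varM k P) (varM k P + varL k P) m.1 m'.1 a b c := by
  rw [add_comm]; rfl

/-- The value in `P[λ, μ]` is the generic one, and every other evaluation is its image under `λ ↦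
S`, `μ ↦ T`. This lemma and the next three transport polynomial axioms to arbitrary commuting
operators. -/
theorem subst₂_evalR (φ : P →ₗ[k] Q) {S T : Module.End k Q} (h : Commute S T)
    (m m' : LambdaMap k P P P) (a b c : P) :
    subst₂ φ S T (evalR (const₂ k P) (varL k P) (varM k P) m.1 m'.1 a b c) =
      evalR φ S T m.1 m'.1 a b c := by
  conv_rhs => rw [← subst₂_const₂ φ S T]
  exact map_evalR _ _ (subst₂_varL φ S T) (subst₂_varM φ h) _ _ _ _ _

theorem subst₂_evalR_swap (φ : P →ₗ[k] Q) {S T : Module.End k Q} (h : Commute S T)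
    (m m' : LambdaMap k P P P) (a b c : P) :
    subst₂ φ S T (evalR (const₂ k P) (varM k P) (varL k P) m.1 m'.1 a b c) =
      evalR φ T S m.1 m'.1 a b c := by
  conv_rhs => rw [← subst₂_const₂ φ S T]
  exact map_evalR _ _ (subst₂_varM φ h) (subst₂_varL φ S T) _ _ _ _ _

theorem subst₂_evalL (φ : P →ₗ[k] Q) {S T : Module.End k Q} (h : Commute S T)
    (m m' : LambdaMap k P P P) (a b c : P) :
    subst₂ φ S T (evalL (const₂ k P) (varL k P) (varL k P + varM k P) m.1 m'.1 a b c) =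
      evalL φ S (S + T) m.1 m'.1 a b c := by
  conv_rhs => rw [← subst₂_const₂ φ S T]
  exact map_evalL _ _ (subst₂_varL φ S T) (subst₂_varL_add_varM φ h) _ _ _ _ _

theorem subst₂_evalL_swap (φ : P →ₗ[k] Q) {S T : Module.End k Q} (h : Commute S T)
    (m m' : LambdaMap k P P P) (a b c : P) :
    subst₂ φ S T (evalL (const₂ k P) (varM k P) (varM k P + varL k P) m.1 m'.1 a b c) =
      evalL φ T (T + S) m.1 m'.1 a b c := by
  conv_rhs => rw [← subst₂_const₂ φ S T, add_comm T S]
  rw [add_comm (varM k P)]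
  exact map_evalL _ _ (subst₂_varM φ h) (subst₂_varL_add_varM φ h) _ _ _ _ _

/-- Commuting operators `D`, `S`, `T`, `N` with sum `0`: values of `∂` and of the variables attached
to the three factors of a nested product. -/
structure IsQuad (D S T N : Module.End k Q) : Prop where
  comm_DS : Commute D S
  comm_DT : Commute D T
  comm_ST : Commute S T
  sum_eq : D + S + T + N = 0

namespace IsQuad

variable {D S T N : Module.End k Q}

theorem eq_last (t : IsQuad D S T N) : N = -D - S - T := by
  rw [eq_neg_of_add_eq_zero_right t.sum_eq]; abel

theorem swap (t : IsQuad D S T N) : IsQuad D T S N :=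
  ⟨t.comm_DT, t.comm_DS, t.comm_ST.symm, by rw [← t.sum_eq]; abel⟩

theorem swap_right (t : IsQuad D S T N) : IsQuad D S N T := by
  refine ⟨t.comm_DS, ?_, ?_, by rw [← t.sum_eq]; abel⟩
  · rw [t.eq_last]
    exact ((Commute.refl D).neg_right.sub_right t.comm_DS).sub_right t.comm_DT
  · rw [t.eq_last]
    exact (t.comm_DS.symm.neg_right.sub_right (Commute.refl S)).sub_right t.comm_ST

end IsQuad

/-! With `∂ + λ + μ + ν = 0` and `λ`, `μ`, `ν` attached to `a`, `b`, `c`, passing to an opposite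
product in a nested product just permutes the factors. -/

theorem op_apply (m : LambdaMap k P P P) (a b : P) : (op m).1 a b = flipVar k P (m.1 b a) := rfl

variable {D S T N : Module.End k Q} {φ : P →ₗ[k] Q}

theorem evalR_op_right (hφ : ∀ v, φ (del k P v) = D (φ v)) (t : IsQuad D S T N)
    (m m' : LambdaMap k P P P) (a b c : P) :
    evalR φ S T m.1 (op m').1 a b c = evalR φ S N m.1 m'.1 a c b := by
  have hN : N = -T - (D + S) := by rw [t.eq_last]; abel
  rw [evalR, op_apply, subst_flipVar (D := D + S) _ (t.comm_DT.add_left t.comm_ST), ← hN, evalR]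
  intro v
  -- Under the outer product `a_S`, the operator `∂` on the inner value acts as `D + S`, so `-T - ∂`
  -- becomes `N`.
  rw [LinearMap.comp_apply, m.2.2, map_add, subst_delPoly hφ t.comm_DS, subst_var]
  rfl

theorem evalR_op_left (hφ : ∀ v, φ (del k P v) = D (φ v)) (t : IsQuad D S T N)
    (m m' : LambdaMap k P P P) (a b c : P) :
    evalR φ S T (op m).1 m'.1 a b c = evalL φ T (T + N) m'.1 m.1 b c a := by
  have hN : T + N = -S - D := by rw [t.eq_last]; abel
  rw [evalR, evalL, hN]
  congr 2
  exact LinearMap.ext fun v => subst_flipVar hφ t.comm_DS _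

theorem evalL_op_left (hST : Commute S T) (m m' : LambdaMap k P P P) (a b c : P) :
    evalL φ S (S + T) (op m).1 m'.1 a b c = evalL φ T (T + S) m.1 m'.1 b a c := by
  -- The inner value is the left argument of an outer product taken at `S + T`, so `∂` acts on it as
  -- `-(S + T)` and `-S - ∂` becomes `T`. No value of `∂` on the result is needed.
  rw [evalL, op_apply, subst_flipVar (D := -(S + T)) _
    ((Commute.refl S).add_left hST.symm).neg_left,
    evalL, add_comm T S]
  · congr 2; abel
  · intro v
    rw [LinearMap.comp_apply, LinearMap.flip_apply, m'.2.1, map_neg, subst_var]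
    rfl

theorem evalL_op_right (hφ : ∀ v, φ (del k P v) = D (φ v)) (t : IsQuad D S T N)
    (m m' : LambdaMap k P P P) (a b c : P) :
    evalL φ S (S + T) m.1 (op m').1 a b c = evalR φ N S m'.1 m.1 c a b := by
  have hN : N = -(S + T) - D := by rw [t.eq_last]; abel
  rw [evalL, evalR, hN]
  congr 2
  exact LinearMap.ext fun v => subst_flipVar hφ (t.comm_DS.add_right t.comm_DT) _

/-- The substitution `λ ↦ -λ - ∂` is an involution because `∂` commutes with `λ`. Skew-symmetry and
commutativity of the associated operations rest on this. -/
theorem op_op (m : LambdaMap k P P P) : op (op m) = m := by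
  refine Subtype.ext (LinearMap.ext₂ fun a b => ?_)
  rw [op_apply, op_apply]
  change subst (const k P) (-var k P - delPoly k P) (flipVar k P (m.1 a b)) = _
  rw [subst_flipVar (φ := const k P) (D := delPoly k P)]
  · rw [show -(-var k P - delPoly k P) - delPoly k P = var k P by abel]
    induction m.1 a b using Finsupp.induction_linear with
    | zero => simp
    | add f g hf hg => simp only [map_add, hf, hg]
    | single n v =>
      rw [subst_single, const, Finsupp.lsingle_apply]
      induction n with
      | zero => rfl
      | succ n ih => rw [pow_succ', Module.End.mul_apply, ih, var_single]
  · intro v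
    simp [const, delPoly_single]
  · have hc : Commute (delPoly k P) (var k P) := LinearMap.ext delPoly_var
    exact hc.neg_right.sub_right (Commute.refl _)

theorem op_add (m m' : LambdaMap k P P P) : op (m + m') = op m + op m' :=
  Subtype.ext (LinearMap.ext₂ fun _ _ => map_add (flipVar k P) _ _)

theorem op_neg (m : LambdaMap k P P P) : op (-m) = -op m :=
  Subtype.ext (LinearMap.ext₂ fun _ _ => map_neg (flipVar k P) _)

end Rules

end Nest

/-! ### The Poisson conformal algebra of a pre-Poisson conformal algebra -/

section Associated

variable {k : Type*} [Field k]
variable {P : Type*} [AddCommGroup P] [Module k P] [Module k[X] P] [IsScalarTower k k[X] P]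
variable {Q : Type*} [AddCommGroup Q] [Module k Q]

/-- The identities of a pre-Poisson conformal algebra, with values in a module under `φ`, the
variables being evaluated at commuting operators, and without opposite products. -/
structure PrePoissonIdentities (ci su : LambdaMap k P P P) (φ : P →ₗ[k] Q) (S T : Module.End k Q)
    (a b c : P) : Prop where
  zinbiel : evalR φ S T su.1 su.1 a b c =
    evalL φ S (S + T) su.1 su.1 a b c + evalL φ T (T + S) su.1 su.1 b a c
  leftSymmetric : evalR φ S T ci.1 ci.1 a b c - evalL φ S (S + T) ci.1 ci.1 a b c =
    evalR φ T S ci.1 ci.1 b a c - evalL φ T (T + S) ci.1 ci.1 b a c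
  compat₁ : evalL φ S (S + T) ci.1 su.1 a b c - evalL φ T (T + S) ci.1 su.1 b a c =
    evalR φ S T ci.1 su.1 a b c - evalR φ T S su.1 ci.1 b a c
  compat₂ : evalL φ S (S + T) su.1 ci.1 a b c + evalL φ T (T + S) su.1 ci.1 b a c =
    evalR φ S T su.1 ci.1 a b c + evalR φ T S su.1 ci.1 b a c

variable {ci su : LambdaMap k P P P}

/-- In the axioms an opposite product occurs only as the inner factor of a left-nested product,
where it just exchanges the first two arguments. Hence commutation of `S` and `T` suffices, with no
operator for `∂`. -/
theorem IsPrePoissonConformal.identities (h : IsPrePoissonConformal ci su) (φ : P →ₗ[k] Q)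
    {S T : Module.End k Q} (hST : Commute S T) (a b c : P) :
    PrePoissonIdentities ci su φ S T a b c := by
  have h1 := congrArg (subst₂ φ S T) (h.zinbiel a b c)
  have h2 := congrArg (subst₂ φ S T) (h.leftSymmetric a b c)
  have h3 := congrArg (subst₂ φ S T) (h.compat₁ a b c)
  have h4 := congrArg (subst₂ φ S T) (h.compat₂ a b c)
  simp only [map_add, map_neg, sub_eq_add_neg, nestR_eq, nestL_eq, nestL_swap_eq,
    subst₂_evalR φ hST,
    subst₂_evalR_swap φ hST, subst₂_evalL φ hST, subst₂_evalL_swap φ hST, evalL_add_left,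
      evalL_neg_left,
    evalL_op_left hST] at h1 h2 h3 h4
  constructor <;> simpa only [sub_eq_add_neg]

theorem isPrePoissonConformal_of_identities
    (h : ∀ a b c, PrePoissonIdentities ci su (const₂ k P) (varL k P) (varM k P) a b c) :
    IsPrePoissonConformal ci su := by
  have hL : ∀ (m m' : LambdaMap k P P P) (a b c : P),
      nestL (op m) m' (varL k P) (varL k P + varM k P) a b c =
        evalL (const₂ k P) (varM k P) (varM k P + varL k P) m.1 m'.1 b a c :=
    fun m m' a b c => evalL_op_left commute_varL_varM m m' a b c
  have hadd : ∀ (m₁ m₂ m' : LambdaMap k P P P) (a b c : P),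
      nestL (m₁ + m₂) m' (varL k P) (varL k P + varM k P) a b c =
        nestL m₁ m' (varL k P) (varL k P + varM k P) a b c +
          nestL m₂ m' (varL k P) (varL k P + varM k P) a b c :=
    fun m₁ m₂ m' a b c => evalL_add_left _ _ _ m₁ m₂ m' a b c
  refine ⟨fun a b c => ?_, fun a b c => ?_, fun a b c => ?_, fun a b c => ?_⟩
  · rw [hadd, hL]; exact (h a b c).zinbiel
  · rw [add_comm (varL k P)]
    have := (h a b c).leftSymmetric
    rw [add_comm (varL k P)] at this
    exact this
  · rw [sub_eq_add_neg, ← op_neg, hadd, hL, evalL_neg_left, ← sub_eq_add_neg]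
    exact (h a b c).compat₁
  · rw [hadd, hL]; exact (h a b c).compat₂

variable {D S T N : Module.End k Q} {φ : P →ₗ[k] Q}

/-- Both sides expand into twelve nested products. Their difference is left-symmetry for `(a, b,
c)`, minus that for `(a, c, b)`, plus that for `(b, c, a)`, the operators `S`, `T`, `N` moving along
with `a`, `b`, `c`. -/
theorem IsPrePoissonConformal.jacobi (h : IsPrePoissonConformal ci su)
    (hφ : ∀ v, φ (del k P v) = D (φ v)) (t : IsQuad D S T N) (a b c : P) :
    evalR φ S T (assocBracket ci).1 (assocBracket ci).1 a b c =
      evalL φ S (S + T) (assocBracket ci).1 (assocBracket ci).1 a b c +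
        evalR φ T S (assocBracket ci).1 (assocBracket ci).1 b a c := by
  simp only [assocBracket, sub_eq_add_neg, evalR_add_left, evalR_add_right, evalL_add_left,
    evalL_add_right, evalR_neg_left, evalR_neg_right, evalL_neg_left, evalL_neg_right,
    evalR_op_right hφ t, evalR_op_right hφ t.swap, evalR_op_right hφ t.swap_right.swap,
    evalR_op_left hφ t, evalR_op_left hφ t.swap, evalR_op_left hφ t.swap_right,
    evalR_op_left hφ t.swap.swap_right, evalL_op_right hφ t, evalL_op_left t.comm_ST]
  have e₁ := (h.identities φ t.comm_ST a b c).leftSymmetric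
  have e₂ := (h.identities φ t.swap_right.comm_ST a c b).leftSymmetric
  have e₃ := (h.identities φ t.swap.swap_right.comm_ST b c a).leftSymmetric
  grind

/-- The Zinbiel identity makes left multiplications commute, `x ≻ (y ≻ z) = y ≻ (x ≻ z)`. With it,
both sides reduce to `a ≻ (b ≻ c) + c ≻ (a ≻ b) + c ≻ (b ≻ a)`. -/
theorem IsPrePoissonConformal.assoc (h : IsPrePoissonConformal ci su)
    (hφ : ∀ v, φ (del k P v) = D (φ v)) (t : IsQuad D S T N) (a b c : P) :
    evalL φ S (S + T) (assocProduct su).1 (assocProduct su).1 a b c =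
      evalR φ S T (assocProduct su).1 (assocProduct su).1 a b c := by
  simp only [assocProduct, evalR_add_left, evalR_add_right, evalL_add_left, evalL_add_right,
    evalR_op_right hφ t, evalR_op_right hφ t.swap_right.swap, evalR_op_left hφ t,
    evalR_op_left hφ t.swap_right, evalL_op_right hφ t, evalL_op_left t.comm_ST]
  have e₁ := (h.identities φ t.comm_ST a b c).zinbiel
  have e₂ := (h.identities φ t.comm_ST.symm b a c).zinbiel
  have e₃ := (h.identities φ t.swap_right.comm_ST a c b).zinbiel
  have e₄ := (h.identities φ t.swap_right.comm_ST.symm c a b).zinbiel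
  have e₅ := (h.identities φ t.swap.swap_right.comm_ST b c a).zinbiel
  have e₆ := (h.identities φ t.swap.swap_right.comm_ST.symm c b a).zinbiel
  grind

/-- After expansion this is `compat₁` for `(a, b, c)` plus `compat₁` for `(a, c, b)` minus `compat₂`
for `(b, c, a)`. -/
theorem IsPrePoissonConformal.leibniz (h : IsPrePoissonConformal ci su)
    (hφ : ∀ v, φ (del k P v) = D (φ v)) (t : IsQuad D S T N) (a b c : P) :
    evalR φ S T (assocBracket ci).1 (assocProduct su).1 a b c =
      evalL φ S (S + T) (assocBracket ci).1 (assocProduct su).1 a b c +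
        evalR φ T S (assocProduct su).1 (assocBracket ci).1 b a c := by
  simp only [assocBracket, assocProduct, sub_eq_add_neg, evalR_add_left, evalR_add_right,
    evalL_add_left, evalL_add_right, evalR_neg_left, evalR_neg_right, evalL_neg_left,
    evalR_op_right hφ t, evalR_op_right hφ t.swap, evalR_op_right hφ t.swap_right.swap,
    evalR_op_left hφ t, evalR_op_left hφ t.swap, evalR_op_left hφ t.swap_right,
    evalR_op_left hφ t.swap.swap_right, evalL_op_right hφ t, evalL_op_left t.comm_ST]
  have e₁ := (h.identities φ t.comm_ST a b c).compat₁
  have e₃ := (h.identities φ t.swap_right.comm_ST a c b).compat₁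
  have e₅ := (h.identities φ t.swap.swap_right.comm_ST b c a).compat₁
  have e₂ := (h.identities φ t.comm_ST a b c).compat₂
  have e₄ := (h.identities φ t.swap_right.comm_ST a c b).compat₂
  have e₆ := (h.identities φ t.swap.swap_right.comm_ST b c a).compat₂
  grind

theorem IsPrePoissonConformal.isPoissonConformal (h : IsPrePoissonConformal ci su) :
    IsPoissonConformal (assocBracket ci) (assocProduct su) := by
  -- The generic case `Q = P[λ, μ]`: the third variable is `ν = -∂ - λ - μ`.
  have t : IsQuad (delPoly₂ k P) (varL k P) (varM k P) (-delPoly₂ k P - varL k P - varM k P) :=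
    ⟨commute_delPoly₂_varL, commute_delPoly₂_varM, commute_varL_varM, by abel⟩
  refine ⟨⟨?_, h.jacobi const₂_del t⟩, ⟨?_, h.assoc const₂_del t⟩, h.leibniz const₂_del t⟩
  · rw [assocBracket, sub_eq_add_neg, op_add, op_neg, op_op]; abel
  · rw [assocProduct, op_add, op_op, add_comm]

end Associated

/-! ### The dual action -/

section DualEval

variable {k : Type*} [Field k]
variable {V Q : Type*} [AddCommGroup V] [Module k[X] V] [AddCommGroup Q] [Module k Q]

variable (k) in
/-- `p ↦ p(K) x`. -/
def polyEval (K : Module.End k Q) (x : Q) : k[X] →ₗ[k] Q :=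
  LinearMap.applyₗ x ∘ₗ (Polynomial.aeval K).toLinearMap

/-- `f ↦ f_K (v) x`. -/
def pairFunctional (K : Module.End k Q) (x : Q) (v : V) : ConformalDual k V →ₗ[k] Q where
  toFun f := polyEval k K x (f.eval v)
  map_add' f g := by rw [ConformalDual.eval_add, map_add]
  map_smul' c f := by rw [ConformalDual.eval_smul, map_smul, RingHom.id_apply]

theorem pairFunctional_apply (K : Module.End k Q) (x : Q) (v : V) (f : ConformalDual k V) :
    pairFunctional K x v f = Polynomial.aeval K (f.eval v) x := rfl

/-- The value at `u` of a polynomial whose coefficients are functionals. -/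
def evalPoly (u : V) (w : ℕ →₀ ConformalDual k V) : k[X][X] :=
  w.sum fun n f => Polynomial.monomial n (f.eval u)

theorem evalPoly_coeff (u : V) (w : ℕ →₀ ConformalDual k V) (n : ℕ) :
    (evalPoly u w).coeff n = (w n).eval u := by
  rw [evalPoly, Finsupp.sum, Polynomial.finsetSum_coeff]
  simp only [Polynomial.coeff_monomial]
  rw [Finset.sum_ite_eq' w.support n]
  split_ifs with h
  · rfl
  · rw [Finsupp.notMem_support_iff.mp h]; rfl

variable [Module k V] [IsScalarTower k k[X] V]

/-- `v ↦ f_K (v) x`. -/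
def pairVector (K : Module.End k Q) (x : Q) (f : ConformalDual k V) : V →ₗ[k] Q :=
  polyEval k K x ∘ₗ f.eval.restrictScalars k

theorem pairVector_apply (K : Module.End k Q) (x : Q) (v : V) (f : ConformalDual k V) :
    pairVector K x f v = Polynomial.aeval K (f.eval v) x := rfl

/-- The pairing `(v, f) ↦ f_K (v) x`. -/
def pairing (K : Module.End k Q) (x : Q) : V →ₗ[k] ConformalDual k V →ₗ[k] Q :=
  LinearMap.mk₂ k (fun v f => pairVector K x f v) (fun _ _ _ => map_add _ _ _)
    (fun _ _ _ => map_smul _ _ _) (fun v _ _ => map_add (pairFunctional K x v) _ _)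
    (fun _ v _ => map_smul (pairFunctional K x v) _ _)

theorem commute_aeval {K S : Module.End k Q} (h : Commute K S) (q : k[X]) :
    Commute (Polynomial.aeval K q) S := by
  induction q using Polynomial.induction_on' with
  | add p q hp hq => rw [map_add]; exact hp.add_left hq
  | monomial n c =>
    rw [Polynomial.aeval_monomial]
    exact (Algebra.commute_algebraMap_left c S).mul_left (h.pow_left n)

/-- Evaluation `k[κ][λ] → End Q` at commuting operators. -/
def evalEnd {K S : Module.End k Q} (h : Commute K S) : k[X][X] →+* Module.End k Q :=
  Polynomial.eval₂RingHom' (Polynomial.aeval K).toRingHom S (commute_aeval h)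

theorem evalEnd_X {K S : Module.End k Q} (h : Commute K S) : evalEnd h Polynomial.X = S :=
  Polynomial.eval₂_X _ _

theorem evalEnd_C {K S : Module.End k Q} (h : Commute K S) (q : k[X]) :
    evalEnd h (Polynomial.C q) = Polynomial.aeval K q :=
  Polynomial.eval₂_C _ _

/-- Both sides are ring homomorphisms in `q`, so it is enough to compare them on constants and on
the variable. This gives `f_{μ-λ}` a meaning at `μ = K`, `λ = S`. -/
theorem evalEnd_shiftHom {K S : Module.End k Q} (h : Commute K S) (q : k[X]) :
    evalEnd h (shiftHom k q) = Polynomial.aeval (K - S) q := by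
  have : (evalEnd h).comp (shiftHom k).toRingHom = (Polynomial.aeval (K - S)).toRingHom := by
    refine Polynomial.ringHom_ext (fun c => ?_) ?_
    · simp only [AlgHom.toRingHom_eq_coe, RingHom.comp_apply, RingHom.coe_coe,
        ← Polynomial.algebraMap_eq, AlgHom.commutes]
      rw [IsScalarTower.algebraMap_apply k k[X] k[X][X], Polynomial.algebraMap_eq,
        evalEnd_C, AlgHom.commutes]
    · simp [shiftHom, evalEnd_X, evalEnd_C]
  exact congrArg (fun F => F q) this

theorem evalEnd_pairShift {K S : Module.End k Q} (h : Commute K S) (x : Q) (f : ConformalDual k V)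
    (w : ℕ →₀ V) : evalEnd h (pairShift f w) x = subst (pairVector (K - S) x f) S w := by
  induction w using Finsupp.induction_linear with
  | zero => simp
  | add v w hv hw => simp only [map_add, LinearMap.add_apply, hv, hw]
  | single n v =>
    rw [pairShift_single, map_mul, map_pow, evalEnd_X, evalEnd_shiftHom, subst_single,
      Module.End.mul_apply, pairVector_apply]

omit [Module k V] [IsScalarTower k k[X] V] in
theorem evalEnd_evalPoly {K S : Module.End k Q} (h : Commute K S) (x : Q) (u : V)
    (w : ℕ →₀ ConformalDual k V) :
    evalEnd h (evalPoly u w) x = subst (pairFunctional K x u) S w := by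
  rw [evalPoly, Finsupp.sum, map_sum, LinearMap.sum_apply, subst_eq_sum, Finsupp.sum]
  refine Finset.sum_congr rfl fun n _ => ?_
  rw [← Polynomial.C_mul_X_pow_eq_monomial, ← Polynomial.X_pow_mul_C, map_mul, map_pow, evalEnd_X,
    evalEnd_C]
  rfl

variable {P : Type*} [AddCommGroup P] [Module k P] [Module k[X] P] [IsScalarTower k k[X] P]

/-- The defining property of the dual action at operators. -/
theorem subst_dualAction [Module.Finite k[X] V] (ρ : LambdaMap k P V V) {K S : Module.End k Q}
    (h : Commute K S) (x : Q) (u : V) (a : P) (f : ConformalDual k V) :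
    subst (pairFunctional K x u) S ((dualAction ρ).1 a f) =
      -subst (pairVector (K - S) x f) S (ρ.1 a u) := by
  -- The dual action is defined one coefficient of `λ` at a time; collecting the coefficients gives
  -- its defining formula in `k[μ][λ]`, which can then be evaluated.
  have : evalPoly u ((dualAction ρ).1 a f) = -pairShift f (ρ.1 a u) :=
    Polynomial.ext fun n => evalPoly_coeff _ _ _
  rw [← evalEnd_evalPoly h, this, map_neg, LinearMap.neg_apply, evalEnd_pairShift]

theorem evalL_dualAction [Module.Finite k[X] V] (m : LambdaMap k P P P) (ρ : LambdaMap k P V V)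
    {K S T : Module.End k Q} (hT : Commute K T) (x : Q) (u : V) (a b : P) (f : ConformalDual k V) :
    evalL (pairFunctional K x u) S T m.1 (dualAction ρ).1 a b f =
      -evalL (pairVector (K - T) x f) S T m.1 ρ.1 a b u := by
  rw [evalL, evalL, ← LinearMap.neg_apply, ← subst_neg]
  congr 2
  exact LinearMap.ext fun v => subst_dualAction ρ hT x u v f

/-- Transposing twice reverses the order of the two operators and cancels the two signs. The index
of the functional drops first by `S`, then by `T`. -/
theorem evalR_dualAction [Module.Finite k[X] V] (ρ ρ' : LambdaMap k P V V)
    {K S T : Module.End k Q} (hS : Commute K S) (hT : Commute K T) (hST : Commute S T) (x : Q)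
    (u : V) (a b : P) (f : ConformalDual k V) :
    evalR (pairFunctional K x u) S T (dualAction ρ).1 (dualAction ρ').1 a b f =
      evalR (pairVector (K - S - T) x f) T S ρ'.1 ρ.1 b a u := by
  have h : ∀ g, (subst (pairFunctional K x u) S ∘ₗ (dualAction ρ).1 a) g =
      subst ((-(pairing (K - S) x : V →ₗ[k] _)).flip g) S (ρ.1 a u) := by
    intro g
    rw [LinearMap.comp_apply, subst_dualAction ρ hS, ← LinearMap.neg_apply, ← subst_neg]
    rfl
  rw [evalR, evalR]
  -- The inner dual action is a polynomial in `T` and `ρ(a) u` a polynomial in `S`. Pairing their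
  -- coefficients in either order lets the second transposition be carried out for each fixed vector
  -- `v`.
  refine subst_comm (-(pairing (K - S) x : V →ₗ[k] _)).flip hST h fun v => ?_
  rw [LinearMap.flip_flip, LinearMap.neg_apply, subst_neg, LinearMap.neg_apply]
  have h' : subst (pairing (K - S) x v) T ((dualAction ρ').1 b f) =
      -subst (pairVector (K - S - T) x f) T (ρ'.1 b v) :=
    subst_dualAction ρ' (hT.sub_left hST) x v b f
  rw [h', neg_neg]
  rfl

end DualEval

/-! ### Semi-direct products of pre-Poisson conformal algebras by dual actions -/

section SemiDirectLemmas

variable {k : Type*} [Field k]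
variable {P V Q : Type*}
  [AddCommGroup P] [Module k P] [Module k[X] P] [IsScalarTower k k[X] P]
  [AddCommGroup V] [Module k V] [Module k[X] V] [IsScalarTower k k[X] V]
  [AddCommGroup Q] [Module k Q]

variable (m m' : LambdaMap k P P P) (l l' : LambdaMap k P V V) (r r' : LambdaMap k V P V)
  (φ : P →ₗ[k] Q) (θ : V →ₗ[k] Q) (S T : Module.End k Q) (p q w : P × V)

theorem semiDirect_apply : (semiDirect m l r).1 p q =
    Finsupp.mapRange.linearMap (LinearMap.inl k P V) (m.1 p.1 q.1) +
      Finsupp.mapRange.linearMap (LinearMap.inr k P V) (l.1 p.1 q.2 + r.1 p.2 q.1) := rfl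

theorem subst_fst_semiDirect :
    subst (φ ∘ₗ LinearMap.fst k P V) T ((semiDirect m l r).1 p q) = subst φ T (m.1 p.1 q.1) := by
  rw [semiDirect_apply, map_add, subst_mapRange, subst_mapRange, LinearMap.comp_assoc,
    LinearMap.comp_assoc, LinearMap.fst_comp_inl, LinearMap.fst_comp_inr, LinearMap.comp_id,
    LinearMap.comp_zero, subst_zero, LinearMap.zero_apply, add_zero]

theorem subst_snd_semiDirect :
    subst (θ ∘ₗ LinearMap.snd k P V) T ((semiDirect m l 0).1 p q) = subst θ T (l.1 p.1 q.2) := by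
  rw [semiDirect_apply, map_add, subst_mapRange, subst_mapRange, LinearMap.comp_assoc,
    LinearMap.comp_assoc, LinearMap.snd_comp_inl, LinearMap.snd_comp_inr, LinearMap.comp_id,
    LinearMap.comp_zero, subst_zero, LinearMap.zero_apply, zero_add]
  congr 1
  exact add_zero _

theorem evalR_fst_semiDirect :
    evalR (φ ∘ₗ LinearMap.fst k P V) S T (semiDirect m l r).1 (semiDirect m' l' r').1 p q w =
      evalR φ S T m.1 m'.1 p.1 q.1 w.1 := by
  have : subst (φ ∘ₗ LinearMap.fst k P V) S ∘ₗ (semiDirect m l r).1 p =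
      (subst φ S ∘ₗ m.1 p.1) ∘ₗ LinearMap.fst k P V :=
    LinearMap.ext fun v => subst_fst_semiDirect m l r φ S p v
  rw [evalR, this, subst_fst_semiDirect]
  rfl

theorem evalL_fst_semiDirect :
    evalL (φ ∘ₗ LinearMap.fst k P V) S T (semiDirect m l r).1 (semiDirect m' l' r').1 p q w =
      evalL φ S T m.1 m'.1 p.1 q.1 w.1 := by
  have : subst (φ ∘ₗ LinearMap.fst k P V) T ∘ₗ (semiDirect m' l' r').1.flip w =
      (subst φ T ∘ₗ m'.1.flip w.1) ∘ₗ LinearMap.fst k P V :=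
    LinearMap.ext fun v => subst_fst_semiDirect m' l' r' φ T v w
  rw [evalL, this, subst_fst_semiDirect]
  rfl

theorem evalR_snd_semiDirect :
    evalR (θ ∘ₗ LinearMap.snd k P V) S T (semiDirect m l 0).1 (semiDirect m' l' 0).1 p q w =
      evalR θ S T l.1 l'.1 p.1 q.1 w.2 := by
  have : subst (θ ∘ₗ LinearMap.snd k P V) S ∘ₗ (semiDirect m l 0).1 p =
      (subst θ S ∘ₗ l.1 p.1) ∘ₗ LinearMap.snd k P V :=
    LinearMap.ext fun v => subst_snd_semiDirect m l θ S p v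
  rw [evalR, this, subst_snd_semiDirect]
  rfl

theorem evalL_snd_semiDirect :
    evalL (θ ∘ₗ LinearMap.snd k P V) S T (semiDirect m l 0).1 (semiDirect m' l' 0).1 p q w =
      evalL θ S T m.1 l'.1 p.1 q.1 w.2 := by
  have : subst (θ ∘ₗ LinearMap.snd k P V) T ∘ₗ (semiDirect m' l' 0).1.flip w =
      (subst θ T ∘ₗ l'.1.flip w.2) ∘ₗ LinearMap.fst k P V :=
    LinearMap.ext fun v => subst_snd_semiDirect m' l' θ T v w
  rw [evalL, this, subst_fst_semiDirect]
  rfl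

theorem flipVar_mapRange {f : P →ₗ[k] V} (hf : ∀ v, f (del k P v) = del k V (f v)) (w : ℕ →₀ P) :
    flipVar k V (Finsupp.mapRange.linearMap f w) =
      Finsupp.mapRange.linearMap f (flipVar k P w) := by
  rw [flipVar, flipVar, subst_mapRange, map_subst _ _ (T' := -var k V - delPoly k V)]
  · congr 2
    ext1 v
    simp [const]
  · intro x
    simp only [LinearMap.sub_apply, LinearMap.neg_apply, map_sub, map_neg, map_var]
    congr 1
    ext1 n
    simp [delPoly, hf]

/-- With zero right action, the opposite product moves the left action to the right slot. A product
and its opposite thus occupy complementary slots and assemble the full semi-direct product. -/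
theorem op_semiDirect : op (semiDirect m l 0) = semiDirect (op m) 0 (op l) := by
  refine Subtype.ext (LinearMap.ext₂ fun p q => ?_)
  rw [op_apply, semiDirect_apply, semiDirect_apply, map_add, flipVar_mapRange, flipVar_mapRange]
  · congr 2
    rw [map_add]
    exact (congrArg _ (map_zero _)).trans (add_comm _ _)
  · exact fun v => Prod.ext (by simp [del]) rfl
  · exact fun v => Prod.ext rfl (by simp [del])

theorem semiDirect_add : semiDirect m l 0 + semiDirect m' 0 r = semiDirect (m + m') l r := by
  refine Subtype.ext (LinearMap.ext₂ fun p q => ?_)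
  change (semiDirect m l 0).1 p q + (semiDirect m' 0 r).1 p q = _
  have h₁ : l.1 p.1 q.2 + (0 : LambdaMap k V P V).1 p.2 q.1 = l.1 p.1 q.2 := add_zero _
  have h₂ : (0 : LambdaMap k P V V).1 p.1 q.2 + r.1 p.2 q.1 = r.1 p.2 q.1 := zero_add _
  have h₃ : (m + m').1 p.1 q.1 = m.1 p.1 q.1 + m'.1 p.1 q.1 := rfl
  simp only [semiDirect_apply, h₁, h₂, h₃, map_add]
  abel

theorem semiDirect_neg : -semiDirect m 0 r = semiDirect (-m) 0 (-r) := by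
  refine Subtype.ext (LinearMap.ext₂ fun p q => ?_)
  change -(semiDirect m 0 r).1 p q = _
  have h₁ : (0 : LambdaMap k P V V).1 p.1 q.2 = 0 := rfl
  have h₂ : (-m).1 p.1 q.1 = -m.1 p.1 q.1 := rfl
  have h₃ : (-r).1 p.2 q.1 = -r.1 p.2 q.1 := rfl
  simp only [semiDirect_apply, h₁, h₂, h₃, zero_add, map_neg, neg_add]

theorem assocBracket_semiDirect :
    assocBracket (semiDirect m l 0) = semiDirectBracket (assocBracket m) l := by
  rw [assocBracket, op_semiDirect, sub_eq_add_neg, semiDirect_neg, semiDirect_add, assocBracket,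
    semiDirectBracket, sub_eq_add_neg]

theorem assocProduct_semiDirect :
    assocProduct (semiDirect m l 0) = semiDirectProduct (assocProduct m) l := by
  rw [assocProduct, op_semiDirect, semiDirect_add, assocProduct, semiDirectProduct]

end SemiDirectLemmas

/-! ### The pre-Poisson structure on the sum of an algebra and its conformal dual. -/

section DualSemiDirect

variable {k : Type*} [Field k]
variable {P : Type*} [AddCommGroup P] [Module k P] [Module k[X] P] [IsScalarTower k k[X] P]

/-- Substituting the variables for themselves only changes coefficients, so evaluation at `λ`, `μ`
loses no information. -/
theorem subst₂_const₂_comp {V W : Type*} [AddCommGroup V] [Module k V] [AddCommGroup W] [Module k W]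
    (g : V →ₗ[k] W) (w : ℕ →₀ ℕ →₀ V) :
    subst₂ (const₂ k W ∘ₗ g) (varL k W) (varM k W) w =
      Finsupp.mapRange.linearMap (Finsupp.mapRange.linearMap g) w := by
  have hM : ∀ (n : ℕ) (x : W), (varM k W ^ n) (const₂ k W x) = const k _ (Finsupp.single n x) := by
    intro n x
    induction n with
    | zero => rfl
    | succ n ih =>
      rw [pow_succ', Module.End.mul_apply, ih]
      simp [varM, const, var_single]
  have hL : ∀ (n : ℕ) (x : ℕ →₀ W), (varL k W ^ n) (const k _ x) = Finsupp.single n x := by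
    intro n x
    induction n with
    | zero => rfl
    | succ n ih => rw [pow_succ', Module.End.mul_apply, ih, varL, var_single]
  induction w using Finsupp.induction_linear with
  | zero => simp
  | add f g hf hg => simp only [map_add, hf, hg]
  | single i v =>
    induction v using Finsupp.induction_linear with
    | zero => simp
    | add f g hf hg => simp only [Finsupp.single_add, map_add, hf, hg]
    | single j x =>
      rw [subst₂, subst_single, subst_single, LinearMap.comp_apply, hM, hL]
      simp

omit [IsScalarTower k k[X] P] in
-- The pairs of evaluations used here are jointly faithful: the coefficients in `P` are read off
-- directly, those in the dual through their values at every `u`.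
theorem eq_of_subst₂_eq {X Y : ℕ →₀ ℕ →₀ P × ConformalDual k P}
    (h₁ : subst₂ (const₂ k P ∘ₗ LinearMap.fst k P (ConformalDual k P)) (varL k P) (varM k P) X =
      subst₂ (const₂ k P ∘ₗ LinearMap.fst k P (ConformalDual k P)) (varL k P) (varM k P) Y)
    (h₂ : ∀ u : P,
      subst₂ (pairFunctional (delPoly₂ k k[X]) (const₂ k k[X] 1) u ∘ₗ
          LinearMap.snd k P (ConformalDual k P)) (varL k k[X]) (varM k k[X]) X =
        subst₂ (pairFunctional (delPoly₂ k k[X]) (const₂ k k[X] 1) u ∘ₗ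
          LinearMap.snd k P (ConformalDual k P)) (varL k k[X]) (varM k k[X]) Y) : X = Y := by
  have hu : ∀ u : P, ∃ g : ConformalDual k P →ₗ[k] k[X], (∀ f, g f = f.eval u) ∧
      pairFunctional (delPoly₂ k k[X]) (const₂ k k[X] 1) u = const₂ k k[X] ∘ₗ g := by
    intro u
    refine ⟨⟨⟨fun f => f.eval u, fun _ _ => rfl⟩, fun _ _ => rfl⟩, fun _ => rfl, ?_⟩
    ext1 f
    -- On `k[X]` the operator `∂` is multiplication by `X`, so `f_∂(u)` applied to `1` is the
    -- polynomial `f.eval u` itself.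
    rw [pairFunctional_apply, ← apply_poly_smul const₂_del, smul_eq_mul, mul_one]
    rfl
  rw [subst₂_const₂_comp, subst₂_const₂_comp] at h₁
  ext1 i
  ext1 j
  refine Prod.ext ?_ (ConformalDual.ext fun u => ?_)
  · simpa using DFunLike.congr_fun (DFunLike.congr_fun h₁ i) j
  · obtain ⟨g, hg, hgu⟩ := hu u
    have h := h₂ u
    rw [hgu, LinearMap.comp_assoc, subst₂_const₂_comp, subst₂_const₂_comp] at h
    simpa [hg] using DFunLike.congr_fun (DFunLike.congr_fun h i) j

variable {V Q : Type*} [AddCommGroup V] [Module k V] [Module k[X] V] [IsScalarTower k k[X] V]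
  [AddCommGroup Q] [Module k Q]
variable {ci su : LambdaMap k P P P}

theorem PrePoissonIdentities.semiDirect_fst {φ : P →ₗ[k] Q} {S T : Module.End k Q}
    {p q w : P × V} (h : PrePoissonIdentities ci su φ S T p.1 q.1 w.1) (l l' : LambdaMap k P V V) :
    PrePoissonIdentities (semiDirect ci l 0) (semiDirect su l' 0) (φ ∘ₗ LinearMap.fst k P V) S T
      p q w := by
  constructor <;> simp only [evalR_fst_semiDirect, evalL_fst_semiDirect]
  exacts [h.zinbiel, h.leftSymmetric, h.compat₁, h.compat₂]

variable [Module.Finite k[X] P]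

/-- Transposition exchanges `a` and `b`, and the sign on the dual of `≻` compensates for the one in
the dual action. The Zinbiel, left-symmetry and first compatibility identities transpose to
themselves. The second becomes `(a ≻ b + b ≻ a) ∘ u = a ∘ (b ≻ u) + b ∘ (a ≻ u)`, which is `compat₂`
corrected by `compat₁` for `(a, b)` and for `(b, a)`, whose left sides cancel. -/
theorem IsPrePoissonConformal.semiDirect_snd (h : IsPrePoissonConformal ci su)
    {K S T : Module.End k Q} (hS : Commute K S) (hT : Commute K T) (hST : Commute S T) (x : Q)
    (u : P) (p q w : P × ConformalDual k P) :
    PrePoissonIdentities (semiDirect ci (dualAction ci) 0) (semiDirect su (-dualAction su) 0)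
      (pairFunctional K x u ∘ₗ LinearMap.snd k P (ConformalDual k P)) S T p q w := by
  have i₁ := h.identities (pairVector (K - S - T) x w.2) hST p.1 q.1 u
  have i₂ := h.identities (pairVector (K - S - T) x w.2) hST.symm q.1 p.1 u
  obtain ⟨h₁, h₂, h₃, h₄⟩ := i₁
  obtain ⟨h₁', -, h₃', -⟩ := i₂
  have e₁ : K - (S + T) = K - S - T := by abel
  have e₂ : K - (T + S) = K - S - T := by abel
  have e₃ : K - T - S = K - S - T := by abel
  constructor <;>
    simp only [evalR_snd_semiDirect, evalL_snd_semiDirect, evalR_neg_left, evalR_neg_right,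
      evalL_neg_right, evalR_dualAction _ _ hS hT hST, evalR_dualAction _ _ hT hS hST.symm,
      evalL_dualAction _ _ (hS.add_right hT), evalL_dualAction _ _ (hT.add_right hS), e₁, e₂,
        e₃] <;>
    grind

/-- The semi-direct product of a pre-Poisson conformal algebra by the dual of its left regular
representation is a pre-Poisson conformal algebra. -/
theorem IsPrePoissonConformal.semiDirect_dualAction (h : IsPrePoissonConformal ci su) :
    IsPrePoissonConformal (semiDirect ci (dualAction ci) 0) (semiDirect su (-dualAction su) 0) := by
  refine isPrePoissonConformal_of_identities fun p q w => ?_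
  have hc := commute_varL_varM (k := k) (V := P)
  have hc' := commute_varL_varM (k := k) (V := k[X])
  have i₁ := (h.identities (const₂ k P) hc p.1 q.1 w.1).semiDirect_fst (dualAction ci)
    (-dualAction su)
  -- The dual component is tested in `k[X][λ, μ]`, the `X` of the coefficients being the variable of
  -- the functionals.
  have i₂ := fun u : P => h.semiDirect_snd commute_delPoly₂_varL commute_delPoly₂_varM hc'
    (const₂ k k[X] 1) u p q w
  constructor <;> refine eq_of_subst₂_eq ?_ fun u => ?_
  all_goals
    simp only [map_add, map_sub, subst₂_evalR _ hc, subst₂_evalR_swap _ hc, subst₂_evalL _ hc,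
      subst₂_evalL_swap _ hc, subst₂_evalR _ hc', subst₂_evalR_swap _ hc', subst₂_evalL _ hc',
      subst₂_evalL_swap _ hc']
  exacts [i₁.zinbiel, (i₂ u).zinbiel, i₁.leftSymmetric, (i₂ u).leftSymmetric, i₁.compat₁,
    (i₂ u).compat₁, i₁.compat₂, (i₂ u).compat₂]

end DualSemiDirect

/-! ### Invariant skew-symmetric elements -/

section Invariant

variable {k : Type*} [Field k]
variable {A Q : Type*} [AddCommGroup A] [Module k A] [Module k[X] A] [IsScalarTower k k[X] A]
  [AddCommGroup Q] [Module k Q] {ι : Type*} [Fintype ι]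

theorem subst_smul {V : Type*} [AddCommGroup V] [Module k V] (c : k) (φ : V →ₗ[k] Q)
    (T : Module.End k Q) : subst (c • φ) T = c • subst φ T := by
  ext; simp [subst]

variable (Q) in
/-- `∑ r_i ⊗ (a_T l_i) = ε ∑ (a_T r_i) ⊗ l_i` for all `a`, in every quotient of `A ⊗ A` on which
`∂ ⊗ I + I ⊗ ∂ + T = 0`. -/
def IsInvariant (m : LambdaMap k A A A) (r l : ι → A) (ε : ℤ) : Prop :=
  ∀ (B : A →ₗ[k] A →ₗ[k] Q) (D D' T : Module.End k Q), (∀ x y, B (del k A x) y = D (B x y)) →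
    (∀ x y, B x (del k A y) = D' (B x y)) → Commute D D' → D + D' + T = 0 → ∀ a : A,
    ∑ i, subst (B (r i)) T (m.1 a (l i)) = ε • ∑ i, subst (B.flip (l i)) T (m.1 a (r i))

variable (Q) in
/-- Skew-symmetry of `∑ r_i ⊗ l_i`. -/
def IsSkewPair (r l : ι → A) : Prop :=
  ∀ G : A →ₗ[k] A →ₗ[k] Q, ∑ i, G (r i) (l i) = -∑ i, G (l i) (r i)

/-- A trilinear map that intertwines the actions of `∂` on the three factors with operators whose sum
vanishes. -/
structure IsEquivariant (F : A →ₗ[k] A →ₗ[k] A →ₗ[k] Q) (D₁ D₂ D₃ : Module.End k Q) : Prop where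
  map₁ : ∀ x y z, F (del k A x) y z = D₁ (F x y z)
  map₂ : ∀ x y z, F x (del k A y) z = D₂ (F x y z)
  map₃ : ∀ x y z, F x y (del k A z) = D₃ (F x y z)
  comm : Commute D₁ D₂
  sum_eq : D₁ + D₂ + D₃ = 0

variable {F : A →ₗ[k] A →ₗ[k] A →ₗ[k] Q} {D₁ D₂ D₃ : Module.End k Q}

namespace IsEquivariant

variable (h : IsEquivariant F D₁ D₂ D₃)

include h

theorem eq₃ : D₃ = -D₁ - D₂ := by rw [eq_neg_of_add_eq_zero_right h.sum_eq]; abel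

theorem comm₁₃ : Commute D₁ D₃ := by
  rw [h.eq₃]; exact (Commute.refl D₁).neg_right.sub_right h.comm

theorem comm₂₃ : Commute D₂ D₃ := by
  rw [h.eq₃]; exact h.comm.symm.neg_right.sub_right (Commute.refl D₂)

variable {m : LambdaMap k A A A} {r l : ι → A} {ε : ℤ}

/-- Invariance in the outer two legs, with `a = r_i`, moves the product from the first leg to the
third and leaves `l_i` in the middle. Skew-symmetry in the pair `(r_i, l_i)` then puts `r_i` in the
middle, at the cost of a sign. -/
theorem sum_slot₁_slot₃ (hm : IsInvariant Q m r l ε) (hs : IsSkewPair (k := k) Q r l) :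
    ∑ i, ∑ j, subst (F (r i) (r j)) D₂ (m.1 (l j) (l i)) =
      -(ε • ∑ i, ∑ j, subst ((F.flip (l i)).flip (l j)) D₂ (m.1 (r i) (r j))) := by
  have h₁ : ∀ i, ∑ j, subst (F (r j) (l i)) D₂ (m.1 (r i) (l j)) =
      ε • ∑ j, subst ((F.flip (l i)).flip (l j)) D₂ (m.1 (r i) (r j)) := fun i =>
    hm (F.flip (l i)) D₁ D₃ D₂ (fun x z => h.map₁ x _ z) (fun x z => h.map₃ x _ z) h.comm₁₃
      (by rw [← h.sum_eq]; abel) (r i)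
  -- The sum over `j`, with the pair `(r_i, l_i)` replaced by free arguments, so that skew-symmetry
  -- applies to it.
  let G : A →ₗ[k] A →ₗ[k] Q := LinearMap.mk₂ k
    (fun x y => ∑ j, subst (F (r j) y) D₂ (m.1 x (l j)))
    (fun x x' y => by simp only [map_add, LinearMap.add_apply, Finset.sum_add_distrib])
    (fun c x y => by simp only [map_smul, LinearMap.smul_apply, Finset.smul_sum])
    (fun x y y' => by simp only [map_add, subst_add, LinearMap.add_apply, Finset.sum_add_distrib])
    (fun c x y => by simp only [map_smul, subst_smul, LinearMap.smul_apply, Finset.smul_sum])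
  have h₂ : ∑ i, ∑ j, subst (F (r j) (l i)) D₂ (m.1 (r i) (l j)) =
      -∑ i, ∑ j, subst (F (r j) (r i)) D₂ (m.1 (l i) (l j)) := hs G
  rw [Finset.sum_comm, ← neg_eq_iff_eq_neg, Finset.smul_sum]
  simp only [← h₁]
  exact h₂.symm

theorem sum_slot₁_slot₂ (hm : IsInvariant Q m r l ε) :
    ∑ i, ∑ j, subst ((F (r i)).flip (l j)) D₃ (m.1 (r j) (l i)) =
      ε • ∑ i, ∑ j, subst ((F.flip (l i)).flip (l j)) D₃ (m.1 (r j) (r i)) := by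
  have h₁ : ∀ j, ∑ i, subst ((F (r i)).flip (l j)) D₃ (m.1 (r j) (l i)) =
      ε • ∑ i, subst ((F.flip (l i)).flip (l j)) D₃ (m.1 (r j) (r i)) := fun j =>
    hm (F.compr₂ (LinearMap.applyₗ (l j))) D₁ D₂ D₃ (fun x y => h.map₁ x y _)
      (fun x y => h.map₂ x y _) h.comm h.sum_eq (r j)
  rw [Finset.sum_comm]
  conv_rhs => rw [Finset.sum_comm]
  rw [Finset.smul_sum]
  exact Finset.sum_congr rfl fun j _ => h₁ j

theorem sum_slot₂_slot₃ (hm : IsInvariant Q m r l ε) :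
    ∑ i, ∑ j, subst (F (r i) (r j)) D₁ (m.1 (l i) (l j)) =
      ε • ∑ i, ∑ j, subst ((F (r i)).flip (l j)) D₁ (m.1 (l i) (r j)) := by
  rw [Finset.smul_sum]
  exact Finset.sum_congr rfl fun i _ =>
    hm (F (r i)) D₂ D₃ D₁ (fun x y => h.map₂ _ x y) (fun x y => h.map₃ _ x y) h.comm₂₃
      (by rw [← h.sum_eq]; abel) (l i)

/-- Since `D₁ + D₂ + D₃ = 0`, reversing a product in one leg exchanges the operators of the other
two legs. The next three lemmas express the same principle. -/
theorem subst_op₁ (x y a b : A) : subst ((F.flip x).flip y) D₂ ((op m).1 a b) =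
    subst ((F.flip x).flip y) D₃ (m.1 b a) := by
  rw [op_apply, subst_flipVar (D := D₁) (fun v => h.map₁ v _ _) h.comm, h.eq₃]
  congr 2; abel

theorem subst_op₂ (x y a b : A) : subst ((F x).flip y) D₃ ((op m).1 a b) =
    subst ((F x).flip y) D₁ (m.1 b a) := by
  rw [op_apply, subst_flipVar (D := D₂) (fun v => h.map₂ _ v _) h.comm₂₃, h.eq₃]
  congr 2; abel

theorem subst_op₃ (x y a b : A) : subst (F x y) D₂ ((op m).1 a b) =
    subst (F x y) D₁ (m.1 b a) := by
  rw [op_apply, subst_flipVar (D := D₃) (fun v => h.map₃ _ _ v) h.comm₂₃.symm, h.eq₃]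
  congr 2; abel

theorem subst_op₃' (x y a b : A) : subst (F x y) D₁ ((op m).1 a b) =
    subst (F x y) D₂ (m.1 b a) := by
  rw [op_apply, subst_flipVar (D := D₃) (fun v => h.map₃ _ _ v) h.comm₁₃.symm, h.eq₃]
  congr 2; abel

/-- Six sums remain after the opposites are removed: legs 1 and 3 carry `D₂`, legs 1 and 2 carry
`D₃`, legs 2 and 3 carry `D₁`. Each pair cancels when `ε = -1`; for the product the signs call for
`ε = 1`. -/
theorem sum_bracket_eq_zero (hm : IsInvariant Q m r l (-1)) (hs : IsSkewPair (k := k) Q r l) :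
    ∑ i, ∑ j, (subst ((F.flip (l i)).flip (l j)) D₂ ((assocBracket m).1 (r i) (r j)) -
      subst ((F (r i)).flip (l j)) D₃ ((assocBracket m).1 (r j) (l i)) -
      subst (F (r i) (r j)) D₂ ((assocBracket m).1 (l j) (l i))) = 0 := by
  have hb : ∀ a b, (assocBracket m).1 a b = m.1 a b - (op m).1 a b := fun _ _ => rfl
  simp only [hb, map_sub, h.subst_op₁, h.subst_op₂, h.subst_op₃, Finset.sum_sub_distrib]
  rw [h.sum_slot₁_slot₃ hm hs, h.sum_slot₁_slot₂ hm, h.sum_slot₂_slot₃ hm]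
  simp only [neg_smul, one_smul]
  abel

theorem sum_bullet_eq_zero (hm : IsInvariant Q m r l 1) (hs : IsSkewPair (k := k) Q r l) :
    ∑ i, ∑ j, (subst (F (r i) (r j)) D₁ ((assocProduct m).1 (l i) (l j)) -
      subst ((F (r i)).flip (l j)) D₃ ((assocProduct m).1 (r j) (l i)) +
      subst ((F.flip (l i)).flip (l j)) D₂ ((assocProduct m).1 (r i) (r j))) = 0 := by
  have hb : ∀ a b, (assocProduct m).1 a b = m.1 a b + (op m).1 a b := fun _ _ => rfl
  simp only [hb, map_add, h.subst_op₁, h.subst_op₂, h.subst_op₃', Finset.sum_sub_distrib,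
    Finset.sum_add_distrib]
  rw [h.sum_slot₁_slot₃ hm hs, h.sum_slot₁_slot₂ hm, h.sum_slot₂_slot₃ hm]
  simp only [one_smul]
  abel

end IsEquivariant

/-! ### The triple tensor product modulo total derivatives. -/

variable (k A) in
/-- `A ⊗ A ⊗ A` modulo the image of `∂^{⊗3}`. -/
abbrev TensorCoinvariants : Type _ := (A ⊗[k] (A ⊗[k] A)) ⧸ LinearMap.range (delTensor₃ k A)

theorem commute_del₁_del₂ : Commute (del₁ k A) (del₂ k A) := by
  refine TensorProduct.ext (LinearMap.ext₂ fun x t => ?_)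
  simp [del₁, del₂]

theorem commute_del₁_del₃ : Commute (del₁ k A) (del₃ k A) := by
  refine TensorProduct.ext (LinearMap.ext₂ fun x t => ?_)
  simp [del₁, del₃]

theorem commute_del₂_del₃ : Commute (del₂ k A) (del₃ k A) := by
  refine TensorProduct.ext_threefold' fun x y z => ?_
  simp [del₂, del₃]

/-- An operator that commutes with `∂^{⊗3}`, on the quotient by its image. -/
def coinvariantsMap (T : Module.End k (A ⊗[k] (A ⊗[k] A))) (h : Commute T (delTensor₃ k A)) :
    Module.End k (TensorCoinvariants k A) :=
  Submodule.mapQ _ _ T (by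
    rintro _ ⟨x, rfl⟩
    exact ⟨T x, (LinearMap.congr_fun h.eq x).symm⟩)

/-- The projection to the quotient by the image of `∂^{⊗3}` is an equivariant trilinear map. -/
theorem exists_equivariant : ∃ (π : A ⊗[k] (A ⊗[k] A) →ₗ[k] TensorCoinvariants k A)
    (D₁ D₂ D₃ : Module.End k (TensorCoinvariants k A))
    (F : A →ₗ[k] A →ₗ[k] A →ₗ[k] TensorCoinvariants k A), IsEquivariant F D₁ D₂ D₃ ∧
      LinearMap.ker π = LinearMap.range (delTensor₃ k A) ∧
      (∀ x y z, F x y z = π (x ⊗ₜ (y ⊗ₜ z))) ∧ (∀ t, π (del₁ k A t) = D₁ (π t)) ∧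
      (∀ t, π (del₂ k A t) = D₂ (π t)) ∧ (∀ t, π (del₃ k A t) = D₃ (π t)) := by
  have c₁ : Commute (del₁ k A) (delTensor₃ k A) :=
    ((Commute.refl _).add_right commute_del₁_del₂).add_right commute_del₁_del₃
  have c₂ : Commute (del₂ k A) (delTensor₃ k A) :=
    (commute_del₁_del₂.symm.add_right (Commute.refl _)).add_right commute_del₂_del₃
  have c₃ : Commute (del₃ k A) (delTensor₃ k A) :=
    (commute_del₁_del₃.symm.add_right commute_del₂_del₃.symm).add_right (Commute.refl _)
  refine ⟨(LinearMap.range (delTensor₃ k A)).mkQ, coinvariantsMap _ c₁, coinvariantsMap _ c₂,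
    coinvariantsMap _ c₃,
    (TensorProduct.lcurry (.id k) A A _).comp
      (TensorProduct.curry (LinearMap.range (delTensor₃ k A)).mkQ),
    ⟨fun x y z => ?_, fun x y z => ?_, fun x y z => ?_, ?_, ?_⟩, Submodule.ker_mkQ _,
      fun x y z => rfl, fun t => rfl,
    fun t => rfl, fun t => rfl⟩
  · rfl
  · rfl
  · rfl
  · refine LinearMap.ext fun t => ?_
    obtain ⟨t, rfl⟩ := Submodule.mkQ_surjective _ t
    exact congrArg (LinearMap.range (delTensor₃ k A)).mkQ
      (LinearMap.congr_fun commute_del₁_del₂.eq t)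
  · refine LinearMap.ext fun t => ?_
    obtain ⟨t, rfl⟩ := Submodule.mkQ_surjective _ t
    exact (Submodule.Quotient.mk_eq_zero _).mpr ⟨t, rfl⟩

theorem map_sum_pow {V M : Type*} [AddCommGroup V] [Module k V] [AddCommGroup M] [Module k M]
    (π : M →ₗ[k] Q) {T : Module.End k M} {D : Module.End k Q} (h : ∀ t, π (T t) = D (π t))
    (g : V → M) (φ : V →ₗ[k] Q) (hφ : ∀ v, φ v = π (g v)) (w : ℕ →₀ V) :
    π (w.sum fun n v => (T ^ n) (g v)) = subst φ D w := by
  rw [Finsupp.sum, map_sum, subst_eq_sum, Finsupp.sum]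
  refine Finset.sum_congr rfl fun n _ => ?_
  rw [apply_pow_of_semiconj h, hφ]

variable {m : LambdaMap k A A A} {r l : ι → A}

theorem doubleBracket_mem_range (hm : IsInvariant (TensorCoinvariants k A) m r l (-1))
    (hs : IsSkewPair (k := k) (TensorCoinvariants k A) r l) :
    doubleBracket (assocBracket m) (∑ i, r i ⊗ₜ l i) ∈ LinearMap.range (delTensor₃ k A) := by
  obtain ⟨π, D₁, D₂, D₃, F, h, hπ, hF, h₁, h₂, h₃⟩ := exists_equivariant (k := k) (A := A)
  rw [← hπ, LinearMap.mem_ker,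
    doubleBracket_sum, ← h.sum_bracket_eq_zero hm hs]
  simp only [map_sum, map_sub]
  refine Finset.sum_congr rfl fun i _ => Finset.sum_congr rfl fun j _ => ?_
  congr 1
  · congr 1
    · exact map_sum_pow π h₂ (fun v => v ⊗ₜ (l i ⊗ₜ l j)) _ (fun v => hF v (l i) (l j)) _
    · exact map_sum_pow π h₃ (fun v => r i ⊗ₜ (v ⊗ₜ l j)) _ (fun v => hF (r i) v (l j)) _
  · exact map_sum_pow π h₂ (fun v => r i ⊗ₜ (r j ⊗ₜ v)) _ (fun v => hF (r i) (r j) v) _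

theorem bulletSquare_mem_range (hm : IsInvariant (TensorCoinvariants k A) m r l 1)
    (hs : IsSkewPair (k := k) (TensorCoinvariants k A) r l) :
    bulletSquare (assocProduct m) (∑ i, r i ⊗ₜ l i) ∈ LinearMap.range (delTensor₃ k A) := by
  obtain ⟨π, D₁, D₂, D₃, F, h, hπ, hF, h₁, h₂, h₃⟩ := exists_equivariant (k := k) (A := A)
  rw [← hπ, LinearMap.mem_ker,
    bulletSquare_sum, ← h.sum_bullet_eq_zero hm hs]
  simp only [map_sum, map_sub, map_add]
  refine Finset.sum_congr rfl fun i _ => Finset.sum_congr rfl fun j _ => ?_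
  -- In the quotient, `-∂^{⊗2} ⊗ I` agrees with `I ⊗ I ⊗ ∂`, the operator that belongs to the second
  -- slot.
  have h₃' : ∀ t, π ((-(del₁ k A + del₂ k A)) t) = D₃ (π t) := by
    intro t
    rw [h.eq₃, LinearMap.neg_apply, LinearMap.add_apply, map_neg, map_add, h₁, h₂]
    simp only [LinearMap.sub_apply, LinearMap.neg_apply]
    abel
  congr 1
  · congr 1
    · exact map_sum_pow π h₁ (fun v => r i ⊗ₜ (r j ⊗ₜ v)) _ (fun v => hF (r i) (r j) v) _
    · exact map_sum_pow π h₃' (fun v => r i ⊗ₜ (v ⊗ₜ l j)) _ (fun v => hF (r i) v (l j)) _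
  · exact map_sum_pow π h₂ (fun v => v ⊗ₜ (l i ⊗ₜ l j)) _ (fun v => hF v (l i) (l j)) _

end Invariant

/-! ### The canonical element -/

section Canonical

variable {k : Type*} [Field k]
variable {P Q : Type*} [AddCommGroup P] [Module k P] [Module k[X] P] [IsScalarTower k k[X] P]
  [AddCommGroup Q] [Module k Q] {n : ℕ} (e : Module.Basis (Fin n) k[X] P)

omit [Module k P] [IsScalarTower k k[X] P] in
theorem sum_eval_smul_dualBasis (f : ConformalDual k P) :
    f = ∑ i, Polynomial.aeval (-Polynomial.X : k[X]) (f.eval (e i)) • dualBasis e i := by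
  have hev : ∀ (g : Fin n → ConformalDual k P) (v : P),
      (∑ i, g i).eval v = ∑ i, (g i).eval v := fun g v => LinearMap.sum_apply _ _ _
  -- Since `∂` acts on functionals as `-λ`, the coordinates of `f` are its values with `λ` replaced
  -- by `-∂`; the two sign changes undo each other.
  have hinv : ∀ p : k[X], Polynomial.aeval (-Polynomial.X : k[X])
      (Polynomial.aeval (-Polynomial.X : k[X]) p) = p := by
    intro p
    rw [← Polynomial.comp_eq_aeval, ← Polynomial.comp_eq_aeval, Polynomial.comp_assoc]
    simp
  ext1 v
  simp only [hev, ConformalDual.eval_poly_smul, hinv]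
  conv_lhs => rw [← e.sum_repr v, map_sum]
  refine Finset.sum_congr rfl fun i _ => ?_
  rw [map_smul, smul_eq_mul, mul_comm]
  rfl

theorem bilinear_eq_sum_pairVector {B : P →ₗ[k] ConformalDual k P →ₗ[k] Q} {D : Module.End k Q}
    (h : ∀ x f, B (del k P x) f = D (B x f)) (f : ConformalDual k P) :
    B.flip f = ∑ i, pairVector D (B (e i) f) (dualBasis e i) := by
  ext1 v
  conv_lhs => rw [← e.sum_repr v, map_sum]
  rw [LinearMap.sum_apply]
  exact Finset.sum_congr rfl fun i _ => apply_poly_smul (fun v => h v f) _ _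

omit [IsScalarTower k k[X] P] in
-- Expansion of `f` in the dual basis; the twist `∂ ↦ -λ` is why `-D` appears. Together with
-- `bilinear_eq_sum_pairVector`, it writes a sesquilinear map in terms of evaluations of
-- functionals, to which the defining formula of the dual action applies.
theorem bilinear_eq_sum_pairFunctional {B : P →ₗ[k] ConformalDual k P →ₗ[k] Q}
    {D : Module.End k Q} (h : ∀ x f, B x (del k _ f) = D (B x f)) (v : P) :
    B v = ∑ i, pairFunctional (-D) (B v (dualBasis e i)) (e i) := by
  ext1 f
  conv_lhs => rw [sum_eval_smul_dualBasis e f, map_sum]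
  rw [LinearMap.sum_apply]
  refine Finset.sum_congr rfl fun i _ => ?_
  rw [apply_poly_smul (fun f => h v f), pairFunctional_apply, ← AlgHom.comp_apply]
  congr 2
  ext1
  simp

/-- Invariance of `∑ e_i ⊗ e_i^*`. -/
theorem sum_subst_dualAction [Module.Finite k[X] P] (ρ : LambdaMap k P P P)
    {B : P →ₗ[k] ConformalDual k P →ₗ[k] Q}
    {D D' T : Module.End k Q} (h : ∀ x f, B (del k P x) f = D (B x f))
    (h' : ∀ x f, B x (del k _ f) = D' (B x f)) (hc : Commute D D') (hs : D + D' + T = 0) (a : P) :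
    ∑ i, subst (B (e i)) T ((dualAction ρ).1 a (dualBasis e i)) =
      -∑ i, subst (B.flip (dualBasis e i)) T (ρ.1 a (e i)) := by
  have hT : T = -D - D' := by rw [eq_neg_of_add_eq_zero_right hs]; abel
  have hc' : Commute (-D') T := by
    rw [hT]; exact (hc.symm.neg_right.sub_right (Commute.refl D')).neg_left
  -- The dual action shifts the index of the functional from `-D'` to `-D' - T`. The relation `D +
  -- D' + T = 0` makes this the index at which vectors are expanded, so both sides become the same
  -- double sum.
  have hD : -D' - T = D := by rw [hT]; abel
  simp only [bilinear_eq_sum_pairVector e h]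
  conv_lhs =>
    enter [2, i]
    rw [bilinear_eq_sum_pairFunctional e h' (e i)]
  simp only [subst_sum, LinearMap.sum_apply, subst_dualAction ρ hc', hD, Finset.sum_neg_distrib]
  rw [Finset.sum_comm]

/-- The left tensor factors of the canonical element. -/
def canonicalLeft : Fin n ⊕ Fin n → P × ConformalDual k P :=
  Sum.elim (fun i => (e i, 0)) (fun i => (0, dualBasis e i))

/-- The right tensor factors of the canonical element. -/
def canonicalRight : Fin n ⊕ Fin n → P × ConformalDual k P :=
  Sum.elim (fun i => (0, dualBasis e i)) (fun i => -(e i, 0))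

omit [IsScalarTower k k[X] P] in
theorem canonicalElement_eq :
    canonicalElement e = ∑ i, canonicalLeft e i ⊗ₜ[k] canonicalRight e i := by
  rw [canonicalElement, Fintype.sum_sum_type, Finset.sum_sub_distrib, sub_eq_add_neg,
    ← Finset.sum_neg_distrib]
  congr 1
  exact Finset.sum_congr rfl fun i _ => (TensorProduct.tmul_neg _ _).symm

omit [IsScalarTower k k[X] P] in
theorem isSkewPair_canonical : IsSkewPair (k := k) Q (canonicalLeft e) (canonicalRight e) := by
  intro G
  simp only [Fintype.sum_sum_type, canonicalLeft, canonicalRight, Sum.elim_inl, Sum.elim_inr,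
    map_neg, LinearMap.neg_apply, Finset.sum_neg_distrib]
  abel

/-- Only the component of `a` in `P` acts. The half `∑ e_i ⊗ e_i^*` is invariant by `hl`, and the
half `-∑ e_i^* ⊗ e_i` by `hl` for the flipped form. -/
theorem isInvariant_canonical (m : LambdaMap k P P P)
    (l : LambdaMap k P (ConformalDual k P) (ConformalDual k P)) {ε : ℤ} (hε : ε * ε = 1)
    (hl : ∀ (B : P →ₗ[k] ConformalDual k P →ₗ[k] Q) (D D' T : Module.End k Q),
      (∀ x f, B (del k P x) f = D (B x f)) → (∀ x f, B x (del k _ f) = D' (B x f)) →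
      Commute D D' → D + D' + T = 0 → ∀ a : P,
      ∑ i, subst (B (e i)) T (l.1 a (dualBasis e i)) =
        ε • ∑ i, subst (B.flip (dualBasis e i)) T (m.1 a (e i))) :
    IsInvariant Q (semiDirect m l 0) (canonicalLeft e) (canonicalRight e) ε := by
  intro B D D' T h h' hc hs a
  have hP : ∀ v : P, del k (P × ConformalDual k P) (v, 0) = (del k P v, 0) := fun v =>
    Prod.ext rfl (smul_zero _)
  have hV : ∀ f : ConformalDual k P,
      del k (P × ConformalDual k P) (0, f) = (0, del k _ f) := fun f =>
    Prod.ext (smul_zero _) rfl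
  have h₁ := hl (B.compl₁₂ (LinearMap.inl k _ _) (LinearMap.inr k _ _)) D D' T
    (fun x f => by
      simp only [LinearMap.compl₁₂_apply, LinearMap.inl_apply, LinearMap.inr_apply, ← hP, h])
    (fun x f => by
      simp only [LinearMap.compl₁₂_apply, LinearMap.inl_apply, LinearMap.inr_apply, ← hV, h'])
    hc hs a.1
  have h₂ := hl (B.flip.compl₁₂ (LinearMap.inl k _ _) (LinearMap.inr k _ _)) D' D T
    (fun x f => by
      simp only [LinearMap.compl₁₂_apply, LinearMap.inl_apply, LinearMap.inr_apply, ← hP,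
        LinearMap.flip_apply, h'])
    (fun x f => by
      simp only [LinearMap.compl₁₂_apply, LinearMap.inl_apply, LinearMap.inr_apply, ← hV,
        LinearMap.flip_apply, h])
    hc.symm (by rw [← hs]; abel) a.1
  have hm₁ : ∀ v : P, (semiDirect m l 0).1 a (v, 0) =
      Finsupp.mapRange.linearMap (LinearMap.inl k P (ConformalDual k P)) (m.1 a.1 v) := by
    intro v
    rw [semiDirect_apply]
    refine (congrArg _ (congrArg _ ?_)).trans ((congrArg _ (map_zero _)).trans (add_zero _))
    exact (congrArg₂ _ (map_zero _) rfl).trans (add_zero _)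
  have hm₂ : ∀ f : ConformalDual k P, (semiDirect m l 0).1 a (0, f) =
      Finsupp.mapRange.linearMap (LinearMap.inr k P (ConformalDual k P)) (l.1 a.1 f) := by
    intro f
    rw [semiDirect_apply]
    refine (congrArg₂ _ ((congrArg _ (map_zero _)).trans (map_zero _)) (congrArg _ ?_)).trans
      (zero_add _)
    exact add_zero _
  simp only [Fintype.sum_sum_type, canonicalLeft, canonicalRight, Sum.elim_inl, Sum.elim_inr,
    map_neg, subst_neg, LinearMap.neg_apply, Finset.sum_neg_distrib, hm₁, hm₂, subst_mapRange]
  have e₁ : ∑ i, subst (B (e i, 0) ∘ₗ LinearMap.inr k P (ConformalDual k P)) T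
      (l.1 a.1 (dualBasis e i)) = ε • ∑ i, subst (B.flip (0, dualBasis e i) ∘ₗ
        LinearMap.inl k P (ConformalDual k P)) T (m.1 a.1 (e i)) := h₁
  have e₂ : ∑ i, subst (B.flip (e i, 0) ∘ₗ LinearMap.inr k P (ConformalDual k P)) T
      (l.1 a.1 (dualBasis e i)) = ε • ∑ i, subst (B (0, dualBasis e i) ∘ₗ
        LinearMap.inl k P (ConformalDual k P)) T (m.1 a.1 (e i)) := h₂
  -- In the flipped half the relation is used from right to left, hence the need for `ε² = 1`.
  rw [e₁, e₂, smul_add, smul_neg, smul_smul, hε, one_smul]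

end Canonical

end PoissonConformal

end

theorem theorem3p20 {k : Type*} [Field k] [CharZero k]
    {P : Type*} [AddCommGroup P] [Module k P] [Module k[X] P] [IsScalarTower k k[X] P]
    [Module.Finite k[X] P]
    (ci su : LambdaMap k P P P) (hP : IsPrePoissonConformal ci su)
    {n : ℕ} (e : Module.Basis (Fin n) k[X] P) :
    IsPoissonConformal (assocBracket ci) (assocProduct su) ∧
      IsPCYBESolution
        (semiDirectBracket (assocBracket ci) (dualAction ci))
        (semiDirectProduct (assocProduct su) (-dualAction su))
        (canonicalElement e) := by
  refine ⟨hP.isPoissonConformal, ?_⟩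
  -- From here the semi-direct product is treated as the Poisson algebra associated with a
  -- pre-Poisson structure.
  rw [← assocBracket_semiDirect, ← assocProduct_semiDirect]
  refine ⟨hP.semiDirect_dualAction.isPoissonConformal, ?_, ?_⟩
  · rw [canonicalElement_eq]
    refine doubleBracket_mem_range (isInvariant_canonical e _ _ (by norm_num) ?_)
      (isSkewPair_canonical e)
    intro B D D' T h h' hc hs a
    rw [sum_subst_dualAction e ci h h' hc hs, neg_smul, one_smul]
  · rw [canonicalElement_eq]
    refine bulletSquare_mem_range (isInvariant_canonical e _ _ (by norm_num) ?_)
      (isSkewPair_canonical e)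
    intro B D D' T h h' hc hs a
    -- The extra sign on the dual of `≻` turns the invariance sign from `-1` into `1`, as the
    -- product requires.
    have hn : ∀ f, (-dualAction su).1 a f = -(dualAction su).1 a f := fun _ => rfl
    simp only [hn, map_neg, Finset.sum_neg_distrib]
    rw [sum_subst_dualAction e su h h' hc hs, neg_neg, one_smul]
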